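/- Let $d\in\{2,3\}$, let $\mathcal T_H$ be a finite conforming triangulation of a polygonal/polyhedral domain $\Omega\subset\mathbb R^d$ by (nondegenerate, closed) $d$-simplices $T$, called macro elements, and let $H=\max_{T\in\mathcal T_H}\operatorname{diam}T$. Let $\mathcal T_h$, $h=2^{-\ell}H$, $\ell=0,1,2,\dots$, be the mesh that arises from $\mathcal T_H$ by $\ell$ steps of uniform refinement, in which every simplex with numbered vertices $x_0,\dots,x_d$ is replaced by $2^d$ simplices: with $x_{ij}=\tfrac12(x_i+x_j)$, for $d=2$ by $[x_0,x_{01},x_{02}]$, $[x_{01},x_1,x_{12}]$, $[x_{02},x_{12},x_2]$, $[x_{01},x_{02},x_{12}]$, and for $d=3$, by Bey's rule, by $[x_0,x_{01},x_{02},x_{03}]$, $[x_{01},x_1,x_{12},x_{13}]$, $[x_{02},x_{12},x_2,x_{23}]$, $[x_{03},x_{13},x_{23},x_3]$, $[x_{01},x_{02},x_{03},x_{13}]$, $[x_{01},x_{02},x_{12},x_{13}]$, $[x_{02},x_{03},x_{13},x_{23}]$, $[x_{02},x_{12},x_{13},x_{23}]$, with vertices numbered in the order in which they are listed. Let $V_h$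 be the space of continuous functions on $\overline\Omega$ that are affine on each $t\in\mathcal T_h$ (no boundary conditions), with nodes $x_i$ and nodal basis functions $\phi_i$. Let $k$ be a scalar coefficient with $k|_T\in W^{2,\infty}(T)$ for every $T\in\mathcal T_H$ (jumps between macro elements are allowed); $k|_T(x_i)$ is the value at $x_i\in T$ of the continuous representative of $k|_T$ on the closed simplex $T$. For $v,w\in V_h$ put $$a(v,w)=\int_\Omega k\,\nabla v\cdot\nabla w\,dx,$$ $$a_h(v,w)=\frac14\sum_{T\in\mathcal T_H}\sum_{i,j}\bigl(k|_T(x_i)+k|_T(x_j)\bigr)\bigl(v(x_i)-v(x_j)\bigr)\bigl(w(x_j)-w(x_i)\bigr)\int_T\nabla\phi_i\cdot\nabla\phi_j\,dx .$$ Let $\|\cdot\|_0$ and $\|\cdot\|_{0;S}$ be the $L^2$-norms on $\Omega$ and on $S$, let $\|\cdot\|_\infty=\sup_{T\in\mathcal T_H}\|\cdot\|_{L^\infty(T)}$, let $\nabla k$ and $Hk$ be the gradient and the Hessian of $k$ taken element-wise with respect to $\mathcal T_H$, and let $S_h=\bigcup_{T\in\mathcal T_H}\bigcup\{t\in\mathcal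 T_h:\partial t\cap\partial T\ne\emptyset\}$. Then there is a constant $C$, independent of $h$, $k$, $v_h$ and $w_h$, such that for all such $h$ and $k$ and all $v_h,w_h\in V_h$ $$\text{(A2)}\quad |a(v_h,w_h)-a_h(v_h,w_h)|\le C\,h\,\|\nabla k\|_\infty\|\nabla v_h\|_0\|\nabla w_h\|_0,$$ $$\text{(A3)}\quad |a(v_h,w_h)-a_h(v_h,w_h)|\le C\bigl(h^2\|Hk\|_\infty\|\nabla v_h\|_0\|\nabla w_h\|_0+h\|\nabla k\|_\infty\|\nabla v_h\|_{0;S_h}\|\nabla w_h\|_{0;S_h}\bigr).$$ Moreover, (A2) holds on unstructured refinements: for every $\sigma>0$ there is a constant $C$ such that the bound (A2), with $V_h$ and $a_h$ formed with $\mathcal T$ in place of $\mathcal T_h$ and with $h=\max_{t\in\mathcal T}\operatorname{diam}t$, holds for all $k$ as above and for every conforming simplicial triangulation $\mathcal T$ of $\Omega$ such that each $t\in\mathcal T$ is contained in some macro element and contains a ball of radius $\operatorname{diam}(t)/\sigma$. -/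

import Mathlib

open scoped ENNReal ContDiff RealInnerProductSpace
open MeasureTheory

noncomputable section

namespace StencilScaling

/-! ### Simplices and simplicial meshes -/

/-- The space `ℝ^d` with its Euclidean norm. -/
abbrev Space (d : ℕ) := EuclideanSpace ℝ (Fin d)

/-- A `d`-simplex in `ℝ^d`, given by its `d + 1` vertices in a fixed local numbering. -/
abbrev Simp (d : ℕ) := Fin (d + 1) → Space d

/-- The closed simplex spanned by the vertices. -/
def body {d : ℕ} (t : Simp d) : Set (Space d) := convexHull ℝ (Set.range t)

/-- The `i`-th barycentric coordinate of a nondegenerate simplex, as an affine function on `ℝ^d`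
(zero if the simplex is degenerate). -/
def bary {d : ℕ} (t : Simp d) (i : Fin (d + 1)) : Space d →ᵃ[ℝ] ℝ :=
  open Classical in
  if h : AffineIndependent ℝ t then
    (AffineBasis.mk t h (h.affineSpan_eq_top_iff_card_eq_finrank_add_one.2 (by simp))).coord i
  else 0

/-- A finite conforming simplicial triangulation: every element is nondegenerate, no simplex is
listed twice, and two elements meet exactly in the (possibly empty) common face that is spanned by
their common vertices. -/
structure IsTriangulation {d : ℕ} (𝒯 : Finset (Simp d)) : Prop where
  nondegenerate : ∀ t ∈ 𝒯, AffineIndependent ℝ t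
  vertexSet_ne : ∀ t ∈ 𝒯, ∀ t' ∈ 𝒯, t ≠ t' → Set.range t ≠ Set.range t'
  inter_eq : ∀ t ∈ 𝒯, ∀ t' ∈ 𝒯, body t ∩ body t' = convexHull ℝ (Set.range t ∩ Set.range t')

/-- The union of the closed elements, i.e. the closure of the domain. -/
def region {d : ℕ} (𝒯 : Finset (Simp d)) : Set (Space d) := ⋃ t ∈ 𝒯, body t

/-- The polyhedral domain `Ω` that is resolved by the mesh. -/
def domain {d : ℕ} (𝒯 : Finset (Simp d)) : Set (Space d) := interior (region 𝒯)

/-- The largest diameter of an element. -/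
def meshSize {d : ℕ} (𝒯 : Finset (Simp d)) : ℝ := ⨆ t : 𝒯, Metric.diam (body t.1)

/-- Every element `t` contains a ball of radius `diam t / σ`. -/
def IsShapeRegular {d : ℕ} (σ : ℝ) (𝒯 : Finset (Simp d)) : Prop :=
  ∀ t ∈ 𝒯, ∃ c, Metric.closedBall c (Metric.diam (body t) / σ) ⊆ body t

/-- The fine mesh `𝒯` subdivides the macro mesh `𝒯H`. -/
def IsRefinementOf {d : ℕ} (𝒯 𝒯H : Finset (Simp d)) : Prop :=
  region 𝒯 = region 𝒯H ∧ ∀ t ∈ 𝒯, ∃ T ∈ 𝒯H, body t ⊆ body T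

/-! ### Uniform refinement -/

/-- The rule of uniform (red) refinement of a simplex `x₀, …, x_d`, for `d = 2, 3`: the list of the
`2^d` children; a pair `(a, b)` stands for the midpoint of `x_a` and `x_b` (so `(a, a)` is the
vertex `x_a`). For `d = 3` this is Bey's rule, including the local numbering of the children, which
decides how the inner octahedron is cut in the next step. -/
def childTable : (d : ℕ) → List (Fin (d + 1) → Fin (d + 1) × Fin (d + 1))
  | 2 => [![(0, 0), (0, 1), (0, 2)],
          ![(0, 1), (1, 1), (1, 2)],
          ![(0, 2), (1, 2), (2, 2)],
          ![(0, 1), (0, 2), (1, 2)]]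
  | 3 => [![(0, 0), (0, 1), (0, 2), (0, 3)],
          ![(0, 1), (1, 1), (1, 2), (1, 3)],
          ![(0, 2), (1, 2), (2, 2), (2, 3)],
          ![(0, 3), (1, 3), (2, 3), (3, 3)],
          ![(0, 1), (0, 2), (0, 3), (1, 3)],
          ![(0, 1), (0, 2), (1, 2), (1, 3)],
          ![(0, 2), (0, 3), (1, 3), (2, 3)],
          ![(0, 2), (1, 2), (1, 3), (2, 3)]]
  | _ => []

/-- The children of a simplex. -/
def children {d : ℕ} (t : Simp d) : List (Simp d) :=
  (childTable d).map fun c i => midpoint ℝ (t (c i).1) (t (c i).2)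

/-- One step of uniform refinement of a mesh. -/
def redRefine {d : ℕ} (𝒯 : Finset (Simp d)) : Finset (Simp d) :=
  open Classical in 𝒯.biUnion fun t => (children t).toFinset

/-- The mesh after `ℓ` steps of uniform refinement of the macro mesh. -/
def uniformMesh {d : ℕ} (𝒯H : Finset (Simp d)) (ℓ : ℕ) : Finset (Simp d) := redRefine^[ℓ] 𝒯H

/-! ### Piecewise linear finite elements -/

/-- The nodes of a mesh: the vertices of its elements. -/
def nodes {d : ℕ} (𝒯 : Finset (Simp d)) : Finset (Space d) :=
  open Classical in 𝒯.biUnion fun t => Finset.univ.image t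

/-- `v` belongs to the space `V_h` of continuous piecewise linear finite elements: on every closed
element it is affine. Continuity on the union of the elements follows, as `v` has one value at each
point of this finite union of closed sets. No boundary values are prescribed; the values outside the
mesh are irrelevant. -/
def IsFE {d : ℕ} (𝒯 : Finset (Simp d)) (v : Space d → ℝ) : Prop :=
  ∀ t ∈ 𝒯, ∃ A : Space d →ᵃ[ℝ] ℝ, ∀ x ∈ body t, v x = A x

/-- The nodal basis function `φ_p` of the node `p`: on an element with vertex `p` it is the
barycentric coordinate that belongs to `p`, elsewhere it is zero. (In a conforming mesh all elements
with vertex `p` that contain `x` give the same value, so that the supremum is over at most one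
number; the supremum over the empty set is zero.) -/
def nodalBasis {d : ℕ} (𝒯 : Finset (Simp d)) (p x : Space d) : ℝ :=
  sSup {r | ∃ t ∈ 𝒯, ∃ i, t i = p ∧ x ∈ body t ∧ r = bary t i x}

/-! ### Coefficients that are piecewise in `W^{2,∞}` -/

/-- `g` is the weak gradient of `f` in the open set `U`. -/
def HasWeakGradient {d : ℕ} (U : Set (Space d)) (f : Space d → ℝ) (g : Space d → Space d) : Prop :=
  LocallyIntegrableOn f U ∧ LocallyIntegrableOn g U ∧
    ∀ φ : Space d → ℝ, ContDiff ℝ ∞ φ → HasCompactSupport φ → tsupport φ ⊆ U →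
      ∀ u : Space d, ∫ x in U, f x * fderiv ℝ φ x u = -∫ x in U, ⟪g x, u⟫ * φ x

/-- `f ∈ W^{2,∞}(U)`, with weak gradient `g` and weak Hessian `G`. -/
structure IsW2Infty {d : ℕ} (U : Set (Space d)) (f : Space d → ℝ) (g : Space d → Space d)
    (G : Space d → Space d →L[ℝ] Space d) : Prop where
  memLp : MemLp f ∞ (volume.restrict U)
  memLp_grad : MemLp g ∞ (volume.restrict U)
  memLp_hess : MemLp G ∞ (volume.restrict U)
  grad : HasWeakGradient U f g
  hess : ∀ u : Space d, HasWeakGradient U (fun x => ⟪g x, u⟫) (fun x => G x u)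

/-- The coefficient `k` is in `W^{2,∞}(T)` for each macro element `T`, with broken gradient `gk`
and broken Hessian `Hk`, and `kT T` is the continuous representative of `k|_T` on the closed
element `T`. There is no condition across the interfaces of the macro elements. -/
structure IsBrokenW2Infty {d : ℕ} (𝒯H : Finset (Simp d)) (k : Space d → ℝ)
    (kT : Simp d → Space d → ℝ) (gk : Space d → Space d)
    (Hk : Space d → Space d →L[ℝ] Space d) : Prop where
  w2infty : ∀ T ∈ 𝒯H, IsW2Infty (interior (body T)) k gk Hk
  continuousOn : ∀ T ∈ 𝒯H, ContinuousOn (kT T) (body T)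
  ae_eq : ∀ T ∈ 𝒯H, k =ᵐ[volume.restrict (body T)] kT T

/-- The broken norm `sup_T ‖f‖_{L^∞(T)}`. -/
def brokenSupNorm {d : ℕ} {F : Type*} [NormedAddCommGroup F] (𝒯H : Finset (Simp d))
    (f : Space d → F) : ℝ :=
  (⨆ T ∈ 𝒯H, eLpNorm f ∞ (volume.restrict (body T))).toReal

/-! ### The bilinear forms -/

/-- `‖∇v‖_{0;S}`. The gradient is the classical one; for finite element functions it exists in the
interior of every element, hence almost everywhere, and is the weak gradient. -/
def gradNorm {d : ℕ} (S : Set (Space d)) (v : Space d → ℝ) : ℝ :=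
  Real.sqrt (∫ x in S, ‖gradient v x‖ ^ 2)

/-- The exact form `a(v, w) = ∫_Ω k ∇v · ∇w`. -/
def exactForm {d : ℕ} (Ω : Set (Space d)) (k v w : Space d → ℝ) : ℝ :=
  ∫ x in Ω, k x * ⟪gradient v x, gradient w x⟫

/-- The stencil-scaled form
`a_h(v, w) = 1/4 ∑_T ∑_{i,j} (k|_T(x_i) + k|_T(x_j)) (v_i - v_j) (w_j - w_i) ∫_T ∇φ_i · ∇φ_j`,
where `T` runs over the macro elements and `i, j` run over the nodes of the fine mesh. -/
def scaledForm {d : ℕ} (𝒯H 𝒯 : Finset (Simp d)) (kT : Simp d → Space d → ℝ)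
    (v w : Space d → ℝ) : ℝ :=
  1 / 4 * ∑ T ∈ 𝒯H, ∑ p ∈ nodes 𝒯, ∑ q ∈ nodes 𝒯,
    (kT T p + kT T q) * (v p - v q) * (w q - w p) *
      ∫ x in body T, ⟪gradient (nodalBasis 𝒯 p) x, gradient (nodalBasis 𝒯 q) x⟫

/-- The strip `S_h`: the union over the macro elements `T` of all fine elements whose boundary meets
the boundary of `T`. -/
def strip {d : ℕ} (𝒯H 𝒯 : Finset (Simp d)) : Set (Space d) :=
  ⋃ T ∈ 𝒯H, ⋃ t ∈ 𝒯, ⋃ (_ : (frontier (body t) ∩ frontier (body T)).Nonempty), body t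

end StencilScaling

end

open StencilScaling

/-!
The consistency error is local. As the gradients of the barycentric coordinates of an element sum to
zero, the exact form can be written, like the scaled one, with differences of nodal values
(`inner_elemGrad`), and the error becomes a sum over all elements `t` and all pairs of vertices of
`t` (`exactForm_sub_scaledForm`); the term of a pair is a weight times the difference of the
integral of `k` over `t` and `|t|` times the mean of `k` at the two vertices. On a shape-regular mesh
the weight is bounded by `‖∇v‖ ‖∇w‖`, and the difference by `h ‖∇k‖ |t|`, since a continuous function
with bounded weak gradient in a convex set is Lipschitz continuous. Summation with the
Cauchy-Schwarz inequality gives the first-order bound (`first_order_bound`), on unstructured meshes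
as well.

For the second-order bound, the term of `t` and an edge is averaged with that of the reflection of
`t` about the midpoint of this edge. Their weights agree, and the sum of the two differences
contains only second differences of `k`, which are bounded by means of the weak Hessian
(`abs_pairError_add_reflect_le`). Where the reflected simplex is not an element of the same macro
element, `t` belongs to the strip `S_h`, and the first-order bound is used
(`second_order_bound`).

What remains is the geometry of uniform refinement. In the coordinates
`x₀ + ∑ₙ yₙ (xₙ₊₁ - xₙ)` the refined mesh of a macro element consists of all simplices of the
Freudenthal triangulation of the lattice `2^{-ℓ} ℤ^d` that lie in it (`mem_uniformMesh`). That
triangulation is invariant under reflections about edge midpoints, and up to scaling and translation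
it has finitely many types of elements, hence is uniformly shape-regular. The children of a simplex
cover it and have the correct total volume, so that they overlap in null sets only
(`volume_inter_children`); no finer conformity is needed, as the gradients of the nodal basis
functions matter only almost everywhere.
-/

namespace StencilScaling

/-! ### Functions with bounded weak derivatives -/

/-- The mollification `y ↦ ∫_U f(x) ψ(y - x) dx` of the zero extension of `f|_U`, where `ψ` is the
normalized bump function belonging to `φ`. -/
noncomputable def mollify {d : ℕ} (φ : ContDiffBump (0 : Space d)) (U : Set (Space d))
    (f : Space d → ℝ) (y : Space d) : ℝ :=
  ∫ x in U, f x * φ.normed volume (y - x)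

theorem mollify_eq_convolution {d : ℕ} (φ : ContDiffBump (0 : Space d)) {U : Set (Space d)}
    (hU : MeasurableSet U) (f : Space d → ℝ) :
    mollify φ U f = convolution (U.indicator f) (φ.normed volume)
      (ContinuousLinearMap.mul ℝ ℝ) volume := by
  ext y
  rw [mollify, convolution_def, ← integral_indicator hU]
  congr 1 with x
  by_cases hx : x ∈ U <;> simp [hx]

theorem tsupport_normed_sub_subset {d : ℕ} (φ : ContDiffBump (0 : Space d)) (y : Space d) :
    tsupport (fun x => φ.normed volume (y - x)) ⊆ Metric.closedBall y φ.rOut := by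
  refine closure_minimal ?_ Metric.isClosed_closedBall
  intro x hx
  have : y - x ∈ Function.support (φ.normed volume) := hx
  rw [φ.support_normed_eq] at this
  rw [Metric.mem_closedBall, dist_comm, dist_eq_norm]
  simpa using (mem_ball_zero_iff.1 this).le

/-- Mollification commutes with weak differentiation away from the boundary. -/
theorem exists_hasFDerivAt_mollify {d : ℕ} (φ : ContDiffBump (0 : Space d)) {U : Set (Space d)}
    (hU : MeasurableSet U) {f : Space d → ℝ} {g : Space d → Space d} (hf : IntegrableOn f U)
    (hw : HasWeakGradient U f g) {y : Space d} (hy : Metric.closedBall y φ.rOut ⊆ U) :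
    ∃ D : Space d →L[ℝ] ℝ, HasFDerivAt (mollify φ U f) D y ∧
      ∀ u, D u = mollify φ U (fun x => ⟪g x, u⟫) y := by
  have hloc : LocallyIntegrable (U.indicator f) volume :=
    ((integrable_indicator_iff hU).2 hf).locallyIntegrable
  have hsm : ContDiff ℝ ∞ (φ.normed (volume : Measure (Space d))) := φ.contDiff_normed
  have hcs : HasCompactSupport (φ.normed (volume : Measure (Space d))) :=
    φ.hasCompactSupport_normed
  refine ⟨convolution (U.indicator f) (fderiv ℝ (φ.normed volume))
    ((ContinuousLinearMap.mul ℝ ℝ).precompR (Space d)) volume y, ?_, ?_⟩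
  · rw [mollify_eq_convolution φ hU f]
    exact hcs.hasFDerivAt_convolution_right _ hloc (hsm.of_le (by exact_mod_cast le_top)) y
  · intro u
    rw [convolution_precompR_apply _ hloc (hcs.fderiv ℝ)
      (hsm.continuous_fderiv (by simp)), convolution_def]
    have h1 : ∀ x, fderiv ℝ (fun x => φ.normed volume (y - x)) x u =
        -fderiv ℝ (φ.normed (volume : Measure (Space d))) (y - x) u := by
      intro x
      have h : HasFDerivAt (fun x : Space d => y - x) (-ContinuousLinearMap.id ℝ (Space d)) x := by
        simpa using (hasFDerivAt_id x).const_sub y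
      have h' : HasFDerivAt (φ.normed (volume : Measure (Space d)))
          (fderiv ℝ (φ.normed volume) (y - x)) (y - x) :=
        (hsm.differentiable (by simp) _).hasFDerivAt
      have h'' : HasFDerivAt (fun x => φ.normed (volume : Measure (Space d)) (y - x)) _ x :=
        h'.comp x h
      rw [h''.fderiv]
      simp
    have hcpt : HasCompactSupport (fun x => φ.normed volume (y - x)) :=
      (isCompact_closedBall y φ.rOut).of_isClosed_subset (isClosed_tsupport _)
        (tsupport_normed_sub_subset φ y)
    have h2 := hw.2.2 (fun x => φ.normed volume (y - x))
      (hsm.comp (contDiff_const.sub contDiff_id)) hcpt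
      ((tsupport_normed_sub_subset φ y).trans hy) u
    simp only [h1, mul_neg, integral_neg, neg_inj] at h2
    rw [mollify, ← h2, ← integral_indicator hU]
    congr 1 with x
    by_cases hx : x ∈ U <;> simp [hx]

theorem integral_normed_sub {d : ℕ} (φ : ContDiffBump (0 : Space d)) (y : Space d) :
    ∫ x, φ.normed volume (y - x) = 1 := by
  rw [integral_sub_left_eq_self (φ.normed volume) volume y]
  exact φ.integral_normed

theorem integrable_normed_sub {d : ℕ} (φ : ContDiffBump (0 : Space d)) (y : Space d) :
    Integrable (fun x => φ.normed volume (y - x)) := by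
  refine Continuous.integrable_of_hasCompactSupport
    (φ.continuous_normed.comp (continuous_const.sub continuous_id)) ?_
  exact (isCompact_closedBall y φ.rOut).of_isClosed_subset (isClosed_tsupport _)
        (tsupport_normed_sub_subset φ y)

theorem abs_mollify_le {d : ℕ} (φ : ContDiffBump (0 : Space d)) {U : Set (Space d)}
    {f : Space d → ℝ} {B : ℝ} (hB : 0 ≤ B)
    (hf : ∀ᵐ x ∂volume.restrict U, |f x| ≤ B) (y : Space d) :
    |mollify φ U f y| ≤ B := by
  have hnn : ∀ z, 0 ≤ φ.normed volume z := φ.nonneg_normed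
  calc |mollify φ U f y| ≤ ∫ x in U, B * φ.normed volume (y - x) := by
        rw [mollify, ← Real.norm_eq_abs]
        refine norm_integral_le_of_norm_le ((integrable_normed_sub φ y).integrableOn.const_mul B) ?_
        filter_upwards [hf] with x hx
        rw [norm_mul, Real.norm_eq_abs, Real.norm_of_nonneg (hnn _)]
        exact mul_le_mul_of_nonneg_right hx (hnn _)
    _ ≤ ∫ x, B * φ.normed volume (y - x) :=
        setIntegral_le_integral ((integrable_normed_sub φ y).const_mul B)
          (Filter.Eventually.of_forall fun x => mul_nonneg hB (hnn _))
    _ = B := by rw [integral_const_mul, integral_normed_sub, mul_one]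

theorem abs_mollify_sub_le {d : ℕ} (φ : ContDiffBump (0 : Space d)) {U : Set (Space d)}
    {f : Space d → ℝ} (hf : IntegrableOn f U) {y : Space d}
    (hy : Metric.closedBall y φ.rOut ⊆ U) {η : ℝ}
    (h : ∀ x ∈ Metric.closedBall y φ.rOut, |f x - f y| ≤ η) :
    |mollify φ U f y - f y| ≤ η := by
  have hnn : ∀ z, 0 ≤ φ.normed volume z := φ.nonneg_normed
  have hη : 0 ≤ η := (abs_nonneg _).trans (h y (Metric.mem_closedBall_self φ.rOut_pos.le))
  have hz : ∀ x, x ∉ Metric.closedBall y φ.rOut → φ.normed volume (y - x) = 0 := fun x hx =>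
    image_eq_zero_of_notMem_tsupport
      (f := fun x => φ.normed volume (y - x)) fun h => hx (tsupport_normed_sub_subset φ y h)
  have e1 : ∫ x in U, f y * φ.normed volume (y - x) = f y := by
    rw [setIntegral_eq_integral_of_forall_compl_eq_zero, integral_const_mul, integral_normed_sub,
      mul_one]
    intro x hx
    rw [hz x fun h => hx (hy h), mul_zero]
  have hsm : Continuous (φ.normed (volume : Measure (Space d))) := φ.continuous_normed
  obtain ⟨C, hC⟩ := φ.hasCompactSupport_normed.exists_bound_of_continuous hsm
  have i1 : IntegrableOn (fun x => f x * φ.normed volume (y - x)) U :=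
    Integrable.mul_bdd (c := C) hf
      (hsm.comp (continuous_const.sub continuous_id)).aestronglyMeasurable
      (Filter.Eventually.of_forall fun x => hC _)
  have e2 : mollify φ U f y - f y = mollify φ U
      ((Metric.closedBall y φ.rOut).indicator fun x => f x - f y) y := by
    conv_lhs => rw [← e1]
    rw [mollify, mollify, ← integral_sub i1 ((integrable_normed_sub φ y).integrableOn.const_mul _)]
    congr 1 with x
    by_cases hx : x ∈ Metric.closedBall y φ.rOut
    · rw [Set.indicator_of_mem hx]
      ring
    · simp [hz x hx]
  rw [e2]
  refine abs_mollify_le φ hη (Filter.Eventually.of_forall fun x => ?_) y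
  by_cases hx : x ∈ Metric.closedBall y φ.rOut
  · rw [Set.indicator_of_mem hx]
    exact h x hx
  · rw [Set.indicator_of_notMem hx]
    simpa using hη

/-- A function that is continuous in the open set `U` is approximated, locally uniformly, by
mollifications. -/
theorem exists_bump_approx {d : ℕ} {U K : Set (Space d)} (hU : IsOpen U) {f : Space d → ℝ}
    (hc : ContinuousOn f U) (hf : IntegrableOn f U) (hK : IsCompact K) (hKU : K ⊆ U) {η : ℝ}
    (hη : 0 < η) :
    ∃ φ : ContDiffBump (0 : Space d), ∀ y ∈ K, Metric.closedBall y φ.rOut ⊆ U ∧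
      |mollify φ U f y - f y| ≤ η := by
  obtain ⟨δ, hδ, hδU⟩ := hK.exists_cthickening_subset_open hU hKU
  have hK' : IsCompact (Metric.cthickening δ K) := hK.cthickening
  have huc := hK'.uniformContinuousOn_of_continuous (hc.mono hδU)
  obtain ⟨ε, hε, hε'⟩ := Metric.uniformContinuousOn_iff.1 huc η hη
  set r := min δ (ε / 2) with hr
  have hr0 : 0 < r := lt_min hδ (by positivity)
  refine ⟨⟨r / 2, r, by positivity, by linarith⟩, fun y hy => ?_⟩
  have hsub : Metric.closedBall y r ⊆ Metric.cthickening δ K :=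
    (Metric.closedBall_subset_closedBall (min_le_left _ _)).trans
      (Metric.closedBall_subset_cthickening hy δ)
  refine ⟨hsub.trans hδU, ?_⟩
  refine abs_mollify_sub_le _ hf (hsub.trans hδU) fun x hx => ?_
  have hx' : dist x y < ε := by
    have := Metric.mem_closedBall.1 hx
    have : dist x y ≤ ε / 2 := this.trans (min_le_right _ _)
    linarith
  have := hε' x (hsub hx) y (hsub (Metric.mem_closedBall_self hr0.le)) hx'
  rw [Real.dist_eq] at this
  exact this.le

theorem abs_mollify_sub_mollify_le {d : ℕ} (φ : ContDiffBump (0 : Space d)) {U : Set (Space d)}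
    (hU : MeasurableSet U) {f : Space d → ℝ} {g : Space d → Space d} (hf : IntegrableOn f U)
    (hw : HasWeakGradient U f g) {L : ℝ} (hL0 : 0 ≤ L)
    (hL : ∀ u, ∀ᵐ x ∂volume.restrict U, |⟪g x, u⟫| ≤ L * ‖u‖) {x y : Space d}
    (hxy : ∀ z ∈ segment ℝ x y, Metric.closedBall z φ.rOut ⊆ U) :
    |mollify φ U f x - mollify φ U f y| ≤ L * ‖x - y‖ := by
  have : ∀ z, ∃ D : Space d →L[ℝ] ℝ, z ∈ segment ℝ x y → HasFDerivAt (mollify φ U f) D z ∧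
      ∀ u, D u = mollify φ U (fun x => ⟪g x, u⟫) z := by
    intro z
    by_cases hz : z ∈ segment ℝ x y
    · obtain ⟨D, hD⟩ := exists_hasFDerivAt_mollify φ hU hf hw (hxy z hz)
      exact ⟨D, fun _ => hD⟩
    · exact ⟨0, fun h => absurd h hz⟩
  choose D hD using this
  refine Convex.norm_image_sub_le_of_norm_hasFDerivWithin_le (𝕜 := ℝ) (s := segment ℝ x y)
    (f' := D) (fun z hz => (hD z hz).1.hasFDerivWithinAt) (fun z hz => ?_) (convex_segment x y)
    (right_mem_segment ℝ x y) (left_mem_segment ℝ x y)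
  refine ContinuousLinearMap.opNorm_le_bound _ hL0 fun u => ?_
  rw [(hD z hz).2, Real.norm_eq_abs]
  exact abs_mollify_le φ (by positivity) (hL u) z

/-- A continuous function with weak gradient bounded by `L` in a convex open set is Lipschitz
continuous with constant `L`. -/
theorem abs_sub_le_of_weakGradient {d : ℕ} {U : Set (Space d)} (hU : IsOpen U) (hconv : Convex ℝ U)
    {f : Space d → ℝ} {g : Space d → Space d} (hc : ContinuousOn f U) (hf : IntegrableOn f U)
    (hw : HasWeakGradient U f g) {L : ℝ} (hL0 : 0 ≤ L)
    (hL : ∀ᵐ x ∂volume.restrict U, ‖g x‖ ≤ L) {x y : Space d} (hx : x ∈ U) (hy : y ∈ U) :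
    |f x - f y| ≤ L * ‖x - y‖ := by
  refine le_of_forall_pos_le_add fun η hη => ?_
  have hcomp : IsCompact (segment ℝ x y) := by
    rw [← convexHull_pair]
    exact (Set.toFinite {x, y}).isCompact_convexHull ℝ
  obtain ⟨φ, hφ⟩ := exists_bump_approx hU hc hf hcomp (hconv.segment_subset hx hy) (half_pos hη)
  have h1 := abs_mollify_sub_mollify_le φ hU.measurableSet hf hw hL0 (fun u => by
    filter_upwards [hL] with z hz
    exact (abs_real_inner_le_norm _ _).trans (by gcongr)) (fun z hz => (hφ z hz).1)
  have h2 := (hφ x (left_mem_segment ℝ x y)).2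
  have h3 := (hφ y (right_mem_segment ℝ x y)).2
  rw [abs_le] at *
  constructor <;> linarith [h1.1, h1.2, h2.1, h2.2, h3.1, h3.2]

/-- A continuous function with weak Hessian bounded by `M` in a convex open set has second
differences of the order `M ‖z‖²`. -/
theorem abs_second_difference_le_of_weakHessian {d : ℕ} {U : Set (Space d)} (hU : IsOpen U)
    (hconv : Convex ℝ U) {f : Space d → ℝ} {g : Space d → Space d}
    {G : Space d → Space d →L[ℝ] Space d} (hc : ContinuousOn f U) (hf : IntegrableOn f U)
    (hw : HasWeakGradient U f g) (hg : ∀ u, IntegrableOn (fun x => ⟪g x, u⟫) U)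
    (hwg : ∀ u : Space d, HasWeakGradient U (fun x => ⟪g x, u⟫) (fun x => G x u)) {M : ℝ}
    (hM0 : 0 ≤ M) (hM : ∀ᵐ x ∂volume.restrict U, ‖G x‖ ≤ M) {m z : Space d} (hp : m + z ∈ U)
    (hn : m - z ∈ U) :
    |f (m + z) + f (m - z) - 2 * f m| ≤ 2 * M * ‖z‖ ^ 2 := by
  refine le_of_forall_pos_le_add fun η hη => ?_
  have hcomp : IsCompact (segment ℝ (m + z) (m - z)) := by
    rw [← convexHull_pair]
    exact (Set.toFinite {m + z, m - z}).isCompact_convexHull ℝ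
  have hseg : ∀ s ∈ Set.Icc (-1 : ℝ) 1, m + s • z ∈ segment ℝ (m + z) (m - z) := by
    intro s hs
    refine ⟨(1 + s) / 2, (1 - s) / 2, by linarith [hs.1], by linarith [hs.2], by ring, ?_⟩
    module
  obtain ⟨φ, hφ⟩ := exists_bump_approx hU hc hf hcomp (hconv.segment_subset hp hn)
    (η := η / 4) (by positivity)
  set F := mollify φ U f with hF
  set F' := mollify φ U (fun x => ⟪g x, z⟫) with hF'
  have hder : ∀ s ∈ Set.Icc (-1 : ℝ) 1,
      HasDerivAt (fun s : ℝ => F (m + s • z)) (F' (m + s • z)) s := by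
    intro s hs
    obtain ⟨D, hD, hDu⟩ := exists_hasFDerivAt_mollify φ hU.measurableSet hf hw
      (hφ _ (hseg s hs)).1
    rw [hF', ← hDu z]
    have : HasDerivAt (fun s : ℝ => m + s • z) z s := by
      simpa using ((hasDerivAt_id s).smul_const z).const_add m
    exact hD.comp_hasDerivAt s this
  have hlip : ∀ s ∈ Set.Icc (0 : ℝ) 1, |F' (m + s • z) - F' (m + (-s) • z)| ≤ 2 * M * ‖z‖ ^ 2 := by
    intro s hs
    have h := abs_mollify_sub_mollify_le φ hU.measurableSet (hg z) (hwg z)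
      (L := M * ‖z‖) (by positivity) (fun u => by
        filter_upwards [hM] with x hx
        refine (abs_real_inner_le_norm _ _).trans ?_
        gcongr
        exact (ContinuousLinearMap.le_opNorm _ _).trans (by gcongr))
      (x := m + s • z) (y := m + (-s) • z) (fun w hw' => (hφ w
        ((convex_segment (m + z) (m - z)).segment_subset
          (hseg s ⟨by linarith [hs.1], hs.2⟩)
          (hseg (-s) ⟨by linarith [hs.2], by linarith [hs.1]⟩) hw')).1)
    refine h.trans ?_
    have : m + s • z - (m + -s • z) = (2 * s) • z := by module
    rw [this, norm_smul, Real.norm_of_nonneg (by linarith [hs.1])]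
    have : M * ‖z‖ ^ 2 * s ≤ M * ‖z‖ ^ 2 := mul_le_of_le_one_right (by positivity) hs.2
    nlinarith
  have key := norm_image_sub_le_of_norm_deriv_le_segment_01'
    (f := fun s : ℝ => F (m + s • z) + F (m + (-s) • z))
    (f' := fun s : ℝ => F' (m + s • z) - F' (m + (-s) • z)) (C := 2 * M * ‖z‖ ^ 2)
    (fun s hs => by
      have h1 := hder s ⟨by linarith [hs.1], hs.2⟩
      have h2 := (hder (-s) ⟨by linarith [hs.2], by linarith [hs.1]⟩).comp s (hasDerivAt_neg s)
      have := h1.add h2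
      simp only [mul_neg, mul_one, ← sub_eq_add_neg] at this
      exact this.hasDerivWithinAt)
    (fun s hs => hlip s ⟨hs.1, hs.2.le⟩)
  simp only [one_smul, neg_smul, zero_smul, neg_zero, add_zero, ← sub_eq_add_neg,
    Real.norm_eq_abs] at key
  have h1 := (hφ (m + z) (left_mem_segment ℝ _ _)).2
  have h2 := (hφ (m - z) (right_mem_segment ℝ _ _)).2
  have h3 := (hφ m (by simpa using hseg 0 (by norm_num))).2
  rw [abs_le] at *
  constructor <;> linarith [key.1, key.2, h1.1, h1.2, h2.1, h2.2, h3.1, h3.2]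

/-! ### Simplices and affine functions -/

/-- The gradient of an affine function. -/
noncomputable def affGrad {d : ℕ} (A : Space d →ᵃ[ℝ] ℝ) : Space d :=
  (InnerProductSpace.toDual ℝ (Space d)).symm (LinearMap.toContinuousLinearMap A.linear)

theorem inner_affGrad {d : ℕ} (A : Space d →ᵃ[ℝ] ℝ) (u : Space d) :
    ⟪affGrad A, u⟫ = A.linear u := by
  simp [affGrad]

theorem inner_affGrad_sub {d : ℕ} (A : Space d →ᵃ[ℝ] ℝ) (x y : Space d) :
    ⟪affGrad A, x - y⟫ = A x - A y := by
  rw [inner_affGrad]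
  exact A.linearMap_vsub x y

theorem affine_eq_linear_add {d : ℕ} (A : Space d →ᵃ[ℝ] ℝ) (y : Space d) :
    A y = A.linear y + A 0 := by
  have h := A.linearMap_vsub y 0
  simp only [vsub_eq_sub, sub_zero] at h
  linarith

theorem hasGradientAt_affine {d : ℕ} (A : Space d →ᵃ[ℝ] ℝ) (x : Space d) :
    HasGradientAt A (affGrad A) x := by
  rw [hasGradientAt_iff_hasFDerivAt, affGrad, LinearIsometryEquiv.apply_symm_apply]
  have h : (A : Space d → ℝ) = fun y => LinearMap.toContinuousLinearMap A.linear y + A 0 := by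
    ext y
    exact affine_eq_linear_add A y
  rw [h]
  exact (ContinuousLinearMap.hasFDerivAt _).add_const _

theorem gradient_eq_of_eventuallyEq {d : ℕ} {v : Space d → ℝ} (A : Space d →ᵃ[ℝ] ℝ) {x : Space d}
    (h : v =ᶠ[nhds x] A) : gradient v x = affGrad A :=
  ((hasGradientAt_affine A x).congr_of_eventuallyEq h).gradient

/-- The vertices of a nondegenerate simplex as an affine basis. -/
noncomputable def vertexBasis {d : ℕ} {t : Simp d} (h : AffineIndependent ℝ t) :
    AffineBasis (Fin (d + 1)) ℝ (Space d) :=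
  AffineBasis.mk t h (h.affineSpan_eq_top_iff_card_eq_finrank_add_one.2 (by simp))

theorem vertexBasis_apply {d : ℕ} {t : Simp d} (h : AffineIndependent ℝ t) (i : Fin (d + 1)) :
    vertexBasis h i = t i := rfl

theorem bary_eq {d : ℕ} {t : Simp d} (h : AffineIndependent ℝ t) (i : Fin (d + 1)) :
    bary t i = (vertexBasis h).coord i := by
  rw [bary, dif_pos h]
  rfl

theorem bary_vertex {d : ℕ} {t : Simp d} (h : AffineIndependent ℝ t) (i j : Fin (d + 1)) :
    bary t i (t j) = if i = j then 1 else 0 := by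
  rw [bary_eq h, ← vertexBasis_apply h, AffineBasis.coord_apply]

theorem sum_bary {d : ℕ} {t : Simp d} (h : AffineIndependent ℝ t) (x : Space d) :
    ∑ i, bary t i x = 1 := by
  simp_rw [bary_eq h]
  exact (vertexBasis h).sum_coord_apply_eq_one x

theorem sum_bary_smul {d : ℕ} {t : Simp d} (h : AffineIndependent ℝ t) (x : Space d) :
    ∑ i, bary t i x • t i = x := by
  simp_rw [bary_eq h]
  exact (vertexBasis h).linear_combination_coord_eq_self x

theorem affine_eq_sum_bary {d : ℕ} {t : Simp d} (h : AffineIndependent ℝ t)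
    (A : Space d →ᵃ[ℝ] ℝ) (x : Space d) : A x = ∑ i, A (t i) * bary t i x := by
  have e := affine_eq_linear_add A
  have h1 : ∑ i, A (t i) * bary t i x = A.linear (∑ i, bary t i x • t i)
      + A 0 * ∑ i, bary t i x := by
    rw [map_sum, Finset.mul_sum, ← Finset.sum_add_distrib]
    refine Finset.sum_congr rfl fun i _ => ?_
    rw [e (t i), map_smul, smul_eq_mul]
    ring
  rw [h1, sum_bary_smul h, sum_bary h, mul_one, ← e]

theorem affGrad_eq_sum {d : ℕ} {t : Simp d} (h : AffineIndependent ℝ t)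
    (A : Space d →ᵃ[ℝ] ℝ) : affGrad A = ∑ i, A (t i) • affGrad (bary t i) := by
  refine ext_inner_right ℝ fun u => ?_
  have hu : u = u - 0 := by simp
  rw [hu, inner_affGrad_sub, sum_inner, affine_eq_sum_bary h A u, affine_eq_sum_bary h A 0,
    ← Finset.sum_sub_distrib]
  refine Finset.sum_congr rfl fun i _ => ?_
  rw [real_inner_smul_left, inner_affGrad_sub]
  ring

theorem sum_affGrad_bary {d : ℕ} {t : Simp d} (h : AffineIndependent ℝ t) :
    ∑ i, affGrad (bary t i) = 0 := by
  refine ext_inner_right ℝ fun u => ?_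
  have hu : u = u - 0 := by simp
  rw [hu, sum_inner]
  simp_rw [inner_affGrad_sub]
  rw [Finset.sum_sub_distrib, sum_bary h, sum_bary h]
  simp

theorem mem_body_iff {d : ℕ} {t : Simp d} (h : AffineIndependent ℝ t) {x : Space d} :
    x ∈ body t ↔ ∀ i, 0 ≤ bary t i x := by
  have := (vertexBasis h).convexHull_eq_nonneg_coord
  simp_rw [bary_eq h]
  exact Set.ext_iff.1 this x

theorem mem_interior_body_iff {d : ℕ} {t : Simp d} (h : AffineIndependent ℝ t) {x : Space d} :
    x ∈ interior (body t) ↔ ∀ i, 0 < bary t i x := by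
  have := (vertexBasis h).interior_convexHull
  simp_rw [bary_eq h]
  exact Set.ext_iff.1 this x

theorem vertex_mem_body {d : ℕ} (t : Simp d) (i : Fin (d + 1)) : t i ∈ body t :=
  subset_convexHull ℝ _ (Set.mem_range_self i)

theorem convex_body {d : ℕ} (t : Simp d) : Convex ℝ (body t) := convex_convexHull ℝ _

theorem isCompact_body {d : ℕ} (t : Simp d) : IsCompact (body t) :=
  (Set.finite_range t).isCompact_convexHull ℝ

theorem isClosed_body {d : ℕ} (t : Simp d) : IsClosed (body t) := (isCompact_body t).isClosed

theorem measurableSet_body {d : ℕ} (t : Simp d) : MeasurableSet (body t) :=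
  (isClosed_body t).measurableSet

theorem volume_body_lt_top {d : ℕ} (t : Simp d) : volume (body t) < ⊤ :=
  (isCompact_body t).measure_lt_top

theorem volume_frontier_body {d : ℕ} (t : Simp d) : volume (frontier (body t)) = 0 :=
  (convex_body t).addHaar_frontier volume

theorem interior_body_ae_eq {d : ℕ} (t : Simp d) :
    interior (body t) =ᵐ[volume] body t :=
  interior_ae_eq_of_null_frontier (volume_frontier_body t)

theorem restrict_interior_body {d : ℕ} (t : Simp d) :
    (volume : Measure (Space d)).restrict (interior (body t)) = volume.restrict (body t) :=
  Measure.restrict_congr_set (interior_body_ae_eq t)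

theorem interior_body_nonempty {d : ℕ} {t : Simp d} (h : AffineIndependent ℝ t) :
    (interior (body t)).Nonempty := by
  refine interior_convexHull_nonempty_iff_affineSpan_eq_top.2 ?_
  exact h.affineSpan_eq_top_iff_card_eq_finrank_add_one.2 (by simp)

theorem volume_body_pos {d : ℕ} {t : Simp d} (h : AffineIndependent ℝ t) :
    0 < volume (body t) :=
  Measure.measure_pos_of_nonempty_interior _ (interior_body_nonempty h)

theorem norm_sub_le_diam_body {d : ℕ} (t : Simp d) {x y : Space d} (hx : x ∈ body t)
    (hy : y ∈ body t) : ‖x - y‖ ≤ Metric.diam (body t) := by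
  rw [← dist_eq_norm]
  exact Metric.dist_le_diam_of_mem (isCompact_body t).isBounded hx hy

/-! ### Pointwise bounds for the coefficient on a macro element -/

theorem HasWeakGradient.congr_ae {d : ℕ} {U : Set (Space d)}
    {k f : Space d → ℝ} {g : Space d → Space d} (hk : HasWeakGradient U k g)
    (hf : k =ᵐ[volume.restrict U] f) (hfi : IntegrableOn f U) : HasWeakGradient U f g := by
  refine ⟨hfi.locallyIntegrableOn, hk.2.1, fun φ h1 h2 h3 u => ?_⟩
  rw [← hk.2.2 φ h1 h2 h3 u]
  refine integral_congr_ae ?_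
  filter_upwards [hf] with x hx
  rw [hx]

/-- Shrinking towards an interior point moves a simplex into its interior, and the original points
are recovered in the limit. -/
theorem tendsto_shrink {d : ℕ} {T : Simp d} {f : Space d → ℝ} (hf : ContinuousOn f (body T))
    {c x : Space d} (hc : c ∈ interior (body T)) (hx : x ∈ body T) :
    (∀ s ∈ Set.Ioc (0 : ℝ) 1, (1 - s) • x + s • c ∈ interior (body T)) ∧
    Filter.Tendsto (fun s : ℝ => f ((1 - s) • x + s • c)) (nhdsWithin 0 (Set.Ioc 0 1))
      (nhds (f x)) := by
  have h1 : ∀ s ∈ Set.Ioc (0 : ℝ) 1, (1 - s) • x + s • c ∈ interior (body T) := fun s hs =>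
    (convex_body T).combo_self_interior_mem_interior hx hc (by linarith [hs.2]) hs.1 (by ring)
  refine ⟨h1, ?_⟩
  refine (hf x hx).tendsto.comp (tendsto_nhdsWithin_iff.2 ⟨?_, ?_⟩)
  · have : Continuous (fun s : ℝ => (1 - s) • x + s • c) := by fun_prop
    have h0 := this.tendsto 0
    simp only [sub_zero, one_smul, zero_smul, add_zero] at h0
    exact h0.mono_left nhdsWithin_le_nhds
  · filter_upwards [self_mem_nhdsWithin] with s hs using interior_subset (h1 s hs)

instance neBot_shrink : (nhdsWithin (0 : ℝ) (Set.Ioc 0 1)).NeBot := by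
  rw [nhdsWithin_Ioc_eq_nhdsGT one_pos]
  infer_instance

/-- The Lipschitz bound holds up to the boundary of the closed macro element. -/
theorem coeff_lipschitz {d : ℕ} {T : Simp d} (hT : AffineIndependent ℝ T)
    {k f : Space d → ℝ} {g : Space d → Space d} {G : Space d → Space d →L[ℝ] Space d}
    (hk : IsW2Infty (interior (body T)) k g G) (hf : ContinuousOn f (body T))
    (hkf : k =ᵐ[volume.restrict (body T)] f) {L : ℝ} (hL0 : 0 ≤ L)
    (hL : ∀ᵐ x ∂volume.restrict (body T), ‖g x‖ ≤ L) {x y : Space d} (hx : x ∈ body T)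
    (hy : y ∈ body T) : |f x - f y| ≤ L * ‖x - y‖ := by
  have hfi : IntegrableOn f (interior (body T)) :=
    (hf.integrableOn_compact (isCompact_body T)).mono_set interior_subset
  obtain ⟨c, hc⟩ := interior_body_nonempty hT
  obtain ⟨hx1, hx2⟩ := tendsto_shrink hf hc hx
  obtain ⟨hy1, hy2⟩ := tendsto_shrink hf hc hy
  refine le_of_tendsto (hx2.sub hy2).abs ?_
  filter_upwards [self_mem_nhdsWithin] with s hs
  refine (abs_sub_le_of_weakGradient isOpen_interior (convex_body T).interior
    (hf.mono interior_subset) hfi (hk.grad.congr_ae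
      (by rwa [restrict_interior_body]) hfi) hL0
    (by rwa [restrict_interior_body]) (hx1 s hs) (hy1 s hs)).trans ?_
  have e : (1 - s) • x + s • c - ((1 - s) • y + s • c) = (1 - s) • (x - y) := by module
  rw [e, norm_smul, Real.norm_of_nonneg (by linarith [hs.2])]
  refine mul_le_mul_of_nonneg_left ?_ hL0
  exact mul_le_of_le_one_left (norm_nonneg _) (by linarith [hs.1])

theorem coeff_second_difference {d : ℕ} {T : Simp d} (hT : AffineIndependent ℝ T)
    {k f : Space d → ℝ} {g : Space d → Space d} {G : Space d → Space d →L[ℝ] Space d}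
    (hk : IsW2Infty (interior (body T)) k g G) (hf : ContinuousOn f (body T))
    (hkf : k =ᵐ[volume.restrict (body T)] f) {M : ℝ} (hM0 : 0 ≤ M)
    (hM : ∀ᵐ x ∂volume.restrict (body T), ‖G x‖ ≤ M) {m z : Space d} (hp : m + z ∈ body T)
    (hn : m - z ∈ body T) : |f (m + z) + f (m - z) - 2 * f m| ≤ 2 * M * ‖z‖ ^ 2 := by
  have hfi : IntegrableOn f (interior (body T)) :=
    (hf.integrableOn_compact (isCompact_body T)).mono_set interior_subset
  have hm : m ∈ body T := by
    have h := (convex_body T) hp hn (by norm_num : (0 : ℝ) ≤ 1 / 2) (by norm_num : (0 : ℝ) ≤ 1 / 2)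
      (by norm_num)
    have e : (1 / 2 : ℝ) • (m + z) + (1 / 2 : ℝ) • (m - z) = m := by module
    rwa [e] at h
  obtain ⟨c, hc⟩ := interior_body_nonempty hT
  obtain ⟨hx1, hx2⟩ := tendsto_shrink hf hc hp
  obtain ⟨hy1, hy2⟩ := tendsto_shrink hf hc hn
  obtain ⟨-, hm2⟩ := tendsto_shrink hf hc hm
  have : IsFiniteMeasure ((volume : Measure (Space d)).restrict (interior (body T))) := by
    rw [restrict_interior_body]
    exact ⟨by simpa using volume_body_lt_top T⟩
  refine le_of_tendsto ((hx2.add hy2).sub (hm2.const_mul 2)).abs ?_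
  filter_upwards [self_mem_nhdsWithin] with s hs
  have e1 : (1 - s) • (m + z) + s • c = ((1 - s) • m + s • c) + (1 - s) • z := by module
  have e2 : (1 - s) • (m - z) + s • c = ((1 - s) • m + s • c) - (1 - s) • z := by module
  have h1 := hx1 s hs
  have h2 := hy1 s hs
  rw [e1] at h1 ⊢
  rw [e2] at h2 ⊢
  refine (abs_second_difference_le_of_weakHessian isOpen_interior (convex_body T).interior
    (hf.mono interior_subset) hfi (hk.grad.congr_ae
      (by rwa [restrict_interior_body]) hfi)
    (fun u => (hk.memLp_grad.integrable le_top).inner_const u) hk.hess hM0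
    (by rwa [restrict_interior_body]) h1 h2).trans ?_
  rw [norm_smul, Real.norm_of_nonneg (by linarith [hs.2])]
  refine mul_le_mul_of_nonneg_left ?_ (by positivity)
  have h01 : 0 ≤ 1 - s := by linarith [hs.2]
  have : (1 - s) * ‖z‖ ≤ ‖z‖ := mul_le_of_le_one_left (norm_nonneg _) (by linarith [hs.1])
  gcongr

/-- The broken norm is a genuine bound: the supremum is finite, so that `ENNReal.toReal` does not
return its junk value. -/
theorem ae_norm_le_brokenSupNorm {d : ℕ} {F : Type*} [NormedAddCommGroup F]
    {𝒯H : Finset (Simp d)} {f : Space d → F}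
    (hf : ∀ T ∈ 𝒯H, MemLp f ∞ (volume.restrict (body T))) {T : Simp d} (hT : T ∈ 𝒯H) :
    ∀ᵐ x ∂volume.restrict (body T), ‖f x‖ ≤ brokenSupNorm 𝒯H f := by
  have hfin : (⨆ T ∈ 𝒯H, eLpNorm f ∞ (volume.restrict (body T))) ≠ ⊤ := by
    rw [← Finset.sup_eq_iSup]
    exact ((Finset.sup_lt_iff (by simp)).2 fun T hT => (hf T hT).2).ne
  have hle := le_iSup₂ (f := fun T (_ : T ∈ 𝒯H) => eLpNorm f ∞ (volume.restrict (body T))) T hT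
  filter_upwards [ae_le_eLpNormEssSup (f := f) (μ := volume.restrict (body T))] with x hx
  rw [brokenSupNorm, ← toReal_enorm]
  refine ENNReal.toReal_mono hfin (le_trans ?_ hle)
  simpa [eLpNorm_exponent_top] using hx

/-! ### Meshes up to null sets -/

/-- A finite family of nondegenerate simplices whose pairwise intersections are null sets. Hanging
nodes are allowed. -/
structure IsTiling {d : ℕ} (𝒯 : Finset (Simp d)) : Prop where
  nondegenerate : ∀ t ∈ 𝒯, AffineIndependent ℝ t
  inter_null : ∀ t ∈ 𝒯, ∀ t' ∈ 𝒯, t ≠ t' → volume (body t ∩ body t') = 0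

theorem IsTiling.subset {d : ℕ} {𝒯 𝒮 : Finset (Simp d)} (h : IsTiling 𝒯) (hs : 𝒮 ⊆ 𝒯) :
    IsTiling 𝒮 :=
  ⟨fun t ht => h.1 t (hs ht), fun t ht t' ht' => h.2 t (hs ht) t' (hs ht')⟩

theorem IsTriangulation.isTiling {d : ℕ} {𝒯 : Finset (Simp d)} (h : IsTriangulation 𝒯) :
    IsTiling 𝒯 := by
  refine ⟨h.nondegenerate, fun t ht t' ht' hne => ?_⟩
  rw [h.inter_eq t ht t' ht']
  have hcard : ∀ s ∈ 𝒯, (Set.range s).ncard = d + 1 := fun s hs => by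
    rw [← Set.image_univ, Set.ncard_image_of_injective _ (h.nondegenerate s hs).injective]
    simp
  -- two different elements have different vertex sets of the same size, so one vertex of `t` is
  -- not shared and the common face lies in the opposite facet
  obtain ⟨i, hi⟩ : ∃ i, t i ∉ Set.range t' := by
    by_contra! hcon
    have hsub : Set.range t ⊆ Set.range t' := Set.range_subset_iff.2 hcon
    refine h.vertexSet_ne t ht t' ht' hne (Set.eq_of_subset_of_ncard_le hsub ?_
      (Set.finite_range _))
    rw [hcard t ht, hcard t' ht']
  have hb := h.nondegenerate t ht
  have hle : (convexHull ℝ) (Set.range t ∩ Set.range t') ⊆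
      (affineSpan ℝ (Set.range t ∩ Set.range t') : Set (Space d)) :=
    convexHull_subset_affineSpan _
  refine measure_mono_null hle (Measure.addHaar_affineSubspace volume _ fun htop => ?_)
  have hsub : Set.range t ∩ Set.range t' ⊆ t '' {j | j ≠ i} := by
    rintro _ ⟨⟨j, rfl⟩, hj⟩
    exact ⟨j, fun e => hi (e ▸ hj), rfl⟩
  have h1 : t i ∈ affineSpan ℝ (t '' {j | j ≠ i}) := by
    have : affineSpan ℝ (Set.range t ∩ Set.range t') ≤ affineSpan ℝ (t '' {j | j ≠ i}) :=
      affineSpan_mono ℝ hsub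
    rw [htop] at this
    exact this (AffineSubspace.mem_top ℝ _ _)
  exact (hb.mem_affineSpan_iff i {j | j ≠ i}).1 h1 rfl

theorem IsTiling.disjoint_interior {d : ℕ} {𝒯 : Finset (Simp d)} (h : IsTiling 𝒯) {t t' : Simp d}
    (ht : t ∈ 𝒯) (ht' : t' ∈ 𝒯) (hne : t ≠ t') :
    Disjoint (interior (body t)) (interior (body t')) := by
  rw [Set.disjoint_iff_inter_eq_empty, ← (isOpen_interior.inter isOpen_interior).measure_eq_zero_iff
    (volume : Measure (Space d))]
  exact measure_mono_null (Set.inter_subset_inter interior_subset interior_subset)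
    (h.2 t ht t' ht' hne)

theorem region_ae_eq {d : ℕ} (𝒯 : Finset (Simp d)) :
    (⋃ t ∈ 𝒯, interior (body t) : Set (Space d)) =ᵐ[volume] region 𝒯 := by
  refine ae_eq_set.2 ⟨?_, ?_⟩
  · rw [Set.sdiff_eq_empty.2, measure_empty]
    exact Set.iUnion₂_mono fun t _ => interior_subset
  · refine measure_mono_null (t := ⋃ t ∈ 𝒯, frontier (body t)) ?_ ?_
    · rintro x ⟨hx, hx'⟩
      simp only [region, Set.mem_iUnion, not_exists, exists_prop] at hx hx' ⊢
      obtain ⟨t, ht, hxt⟩ := hx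
      exact ⟨t, ht, subset_closure hxt, fun hi => hx' t ⟨ht, hi⟩⟩
    · refine (measure_biUnion_null_iff 𝒯.countable_toSet).2 fun t _ => volume_frontier_body t

theorem domain_ae_eq {d : ℕ} (𝒯 : Finset (Simp d)) :
    domain 𝒯 =ᵐ[volume] region 𝒯 := by
  have h1 : (⋃ t ∈ 𝒯, interior (body t) : Set (Space d)) ⊆ domain 𝒯 :=
    Set.iUnion₂_subset fun t ht => interior_mono (Set.subset_biUnion_of_mem (u := body) ht)
  refine Filter.EventuallyLE.antisymm (LE.le.eventuallyLE interior_subset) ?_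
  exact (region_ae_eq 𝒯).symm.le.trans (LE.le.eventuallyLE h1)

theorem IsTiling.setIntegral_region {d : ℕ} {𝒯 : Finset (Simp d)} (h : IsTiling 𝒯)
    {f : Space d → ℝ} (hf : ∀ t ∈ 𝒯, IntegrableOn f (body t)) :
    ∫ x in region 𝒯, f x = ∑ t ∈ 𝒯, ∫ x in body t, f x := by
  rw [← setIntegral_congr_set (region_ae_eq 𝒯), integral_biUnion_finset]
  · exact Finset.sum_congr rfl fun t _ => setIntegral_congr_set (interior_body_ae_eq t)
  · exact fun t _ => isOpen_interior.measurableSet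
  · exact fun t ht t' ht' hne => h.disjoint_interior ht ht' hne
  · exact fun t ht => (hf t ht).mono_set interior_subset

open Classical in
/-- The elements of `𝒯` inside the macro element `T`. -/
noncomputable def elementsIn {d : ℕ} (𝒯 : Finset (Simp d)) (T : Simp d) : Finset (Simp d) :=
  𝒯.filter fun t => body t ⊆ body T

theorem mem_elementsIn {d : ℕ} {𝒯 : Finset (Simp d)} {T t : Simp d} :
    t ∈ elementsIn 𝒯 T ↔ t ∈ 𝒯 ∧ body t ⊆ body T := by
  classical
  simp [elementsIn]

theorem elementsIn_subset {d : ℕ} (𝒯 : Finset (Simp d)) (T : Simp d) : elementsIn 𝒯 T ⊆ 𝒯 :=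
  fun _ ht => (mem_elementsIn.1 ht).1

theorem IsTiling.eq_of_subset {d : ℕ} {𝒯H : Finset (Simp d)} (hH : IsTiling 𝒯H)
    {t T T' : Simp d} (ht : AffineIndependent ℝ t) (hT : T ∈ 𝒯H) (hT' : T' ∈ 𝒯H)
    (h : body t ⊆ body T) (h' : body t ⊆ body T') : T = T' := by
  by_contra hne
  exact (volume_body_pos ht).ne' (measure_mono_null (Set.subset_inter h h')
    (hH.inter_null T hT T' hT' hne))

theorem sum_elementsIn {d : ℕ} {𝒯 𝒯H : Finset (Simp d)} (hH : IsTiling 𝒯H) (h : IsTiling 𝒯)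
    (hr : IsRefinementOf 𝒯 𝒯H) (f : Simp d → ℝ) :
    ∑ T ∈ 𝒯H, ∑ t ∈ elementsIn 𝒯 T, f t = ∑ t ∈ 𝒯, f t := by
  classical
  rw [← Finset.sum_biUnion]
  · refine Finset.sum_congr ?_ fun _ _ => rfl
    ext t
    simp only [Finset.mem_biUnion, mem_elementsIn]
    exact ⟨fun ⟨T, _, ht, _⟩ => ht, fun ht => (hr.2 t ht).imp fun T hT => ⟨hT.1, ht, hT.2⟩⟩
  · intro T hT T' hT' hne
    refine Finset.disjoint_left.2 fun t ht ht' => hne ?_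
    rw [mem_elementsIn] at ht ht'
    exact hH.eq_of_subset (h.nondegenerate t ht.1) hT hT' ht.2 ht'.2

theorem body_ae_eq_region_elementsIn {d : ℕ} {𝒯 𝒯H : Finset (Simp d)} (hH : IsTiling 𝒯H)
    (hr : IsRefinementOf 𝒯 𝒯H) {T : Simp d} (hT : T ∈ 𝒯H) :
    region (elementsIn 𝒯 T) =ᵐ[volume] body T := by
  refine ae_eq_set.2 ⟨?_, ?_⟩
  · rw [Set.sdiff_eq_empty.2, measure_empty]
    exact Set.iUnion₂_subset fun t ht => (mem_elementsIn.1 ht).2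
  · classical
    refine measure_mono_null (t := ⋃ T' ∈ 𝒯H.erase T, body T ∩ body T') ?_ ?_
    · rintro x ⟨hx, hx'⟩
      have hxr : x ∈ region 𝒯 := by
        rw [hr.1]
        exact Set.mem_biUnion hT hx
      simp only [region, Set.mem_iUnion, not_exists, exists_prop] at hxr hx'
      obtain ⟨t, ht, hxt⟩ := hxr
      obtain ⟨T', hT', htT'⟩ := hr.2 t ht
      have hne : T' ≠ T := by
        rintro rfl
        exact hx' t ⟨mem_elementsIn.2 ⟨ht, htT'⟩, hxt⟩
      exact Set.mem_biUnion (Finset.mem_erase.2 ⟨hne, hT'⟩) ⟨hx, htT' hxt⟩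
    · refine (measure_biUnion_null_iff (Finset.countable_toSet _)).2 fun T' hT' => ?_
      have := Finset.mem_erase.1 hT'
      exact hH.inter_null T hT T' this.2 this.1.symm

theorem setIntegral_macro {d : ℕ} {𝒯 𝒯H : Finset (Simp d)} (hH : IsTiling 𝒯H) (h : IsTiling 𝒯)
    (hr : IsRefinementOf 𝒯 𝒯H) {T : Simp d} (hT : T ∈ 𝒯H) {f : Space d → ℝ}
    (hf : ∀ t ∈ elementsIn 𝒯 T, IntegrableOn f (body t)) :
    ∫ x in body T, f x = ∑ t ∈ elementsIn 𝒯 T, ∫ x in body t, f x := by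
  rw [← setIntegral_congr_set (body_ae_eq_region_elementsIn hH hr hT)]
  exact (h.subset (elementsIn_subset 𝒯 T)).setIntegral_region hf

/-! ### Gradients of finite element functions -/

/-- The gradient on the element `t` of the affine interpolant of `v` in the vertices of `t`. -/
noncomputable def elemGrad {d : ℕ} (t : Simp d) (v : Space d → ℝ) : Space d :=
  ∑ i, v (t i) • affGrad (bary t i)

theorem gradient_fe {d : ℕ} {𝒯 : Finset (Simp d)} (h : IsTiling 𝒯) {v : Space d → ℝ}
    (hv : IsFE 𝒯 v) {t : Simp d} (ht : t ∈ 𝒯) {x : Space d} (hx : x ∈ interior (body t)) :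
    gradient v x = elemGrad t v := by
  obtain ⟨A, hA⟩ := hv t ht
  rw [gradient_eq_of_eventuallyEq A, affGrad_eq_sum (h.nondegenerate t ht), elemGrad]
  · exact Finset.sum_congr rfl fun i _ => by rw [hA _ (vertex_mem_body t i)]
  · filter_upwards [isOpen_interior.mem_nhds hx] with y hy using hA y (interior_subset hy)

theorem inner_elemGrad_sub {d : ℕ} {𝒯 : Finset (Simp d)} (h : IsTiling 𝒯) {v : Space d → ℝ}
    (hv : IsFE 𝒯 v) {t : Simp d} (ht : t ∈ 𝒯) (i j : Fin (d + 1)) :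
    ⟪elemGrad t v, t i - t j⟫ = v (t i) - v (t j) := by
  obtain ⟨A, hA⟩ := hv t ht
  rw [hA _ (vertex_mem_body t i), hA _ (vertex_mem_body t j), ← inner_affGrad_sub,
    affGrad_eq_sum (h.nondegenerate t ht), elemGrad]
  congr 1
  exact Finset.sum_congr rfl fun i _ => by rw [hA _ (vertex_mem_body t i)]

theorem ae_gradient_fe {d : ℕ} {𝒯 : Finset (Simp d)} (h : IsTiling 𝒯) {v : Space d → ℝ}
    (hv : IsFE 𝒯 v) {t : Simp d} (ht : t ∈ 𝒯) :
    ∀ᵐ x ∂volume.restrict (body t), gradient v x = elemGrad t v := by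
  rw [← restrict_interior_body]
  filter_upwards [ae_restrict_mem isOpen_interior.measurableSet] with x hx
  exact gradient_fe h hv ht hx

/-- The gradient on the element `t` of the nodal basis function of the node `p`. -/
noncomputable def nodalGrad {d : ℕ} (t : Simp d) (p : Space d) : Space d :=
  open Classical in ∑ i, if t i = p then affGrad (bary t i) else 0

/-- Away from the other elements, the supremum in the definition of the nodal basis function is over
at most one number. -/
theorem ae_gradient_nodalBasis {d : ℕ} {𝒯 : Finset (Simp d)} (h : IsTiling 𝒯) {t : Simp d}
    (ht : t ∈ 𝒯) (p : Space d) :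
    ∀ᵐ x ∂volume.restrict (body t), gradient (nodalBasis 𝒯 p) x = nodalGrad t p := by
  classical
  have hnull : volume (⋃ t' ∈ 𝒯.erase t, body t ∩ body t') = 0 := by
    refine (measure_biUnion_null_iff (Finset.countable_toSet _)).2 fun t' ht' => ?_
    have := Finset.mem_erase.1 ht'
    exact h.inter_null t ht t' this.2 this.1.symm
  rw [← restrict_interior_body]
  filter_upwards [ae_restrict_mem isOpen_interior.measurableSet,
    ae_restrict_of_ae (measure_eq_zero_iff_ae_notMem.1 hnull)] with x hx hx'
  have hO : IsOpen (interior (body t) ∩ (⋃ t' ∈ 𝒯.erase t, body t')ᶜ) :=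
    isOpen_interior.inter ((Set.Finite.isClosed_biUnion (Finset.finite_toSet _)
      fun t' _ => isClosed_body t').isOpen_compl)
  have hxO : x ∈ interior (body t) ∩ (⋃ t' ∈ 𝒯.erase t, body t')ᶜ := by
    refine ⟨hx, fun hc => hx' ?_⟩
    simp only [Set.mem_iUnion, exists_prop] at hc ⊢
    exact hc.imp fun t' ht' => ⟨ht'.1, interior_subset hx, ht'.2⟩
  have hunique : ∀ y ∈ interior (body t) ∩ (⋃ t' ∈ 𝒯.erase t, body t')ᶜ,
      ∀ t' ∈ 𝒯, y ∈ body t' → t' = t := by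
    intro y hy t' ht' hyt'
    by_contra hne
    exact hy.2 (Set.mem_biUnion (Finset.mem_erase.2 ⟨hne, ht'⟩) hyt')
  have hinj := (h.nondegenerate t ht).injective
  by_cases hp : ∃ i, t i = p
  · obtain ⟨i, rfl⟩ := hp
    have e : nodalGrad t (t i) = affGrad (bary t i) := by
      rw [nodalGrad, Finset.sum_eq_single i]
      · simp
      · exact fun j _ hj => if_neg fun h => hj (hinj h)
      · simp
    rw [e]
    refine gradient_eq_of_eventuallyEq _ ?_
    filter_upwards [hO.mem_nhds hxO] with y hy
    have : {r | ∃ t' ∈ 𝒯, ∃ j, t' j = t i ∧ y ∈ body t' ∧ r = bary t' j y} = {bary t i y} := by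
      ext r
      constructor
      · rintro ⟨t', ht', j, hj, hy', rfl⟩
        obtain rfl := hunique y hy t' ht' hy'
        rw [hinj hj]
        rfl
      · rintro rfl
        exact ⟨t, ht, i, rfl, interior_subset hy.1, rfl⟩
    rw [nodalBasis, this, csSup_singleton]
  · push Not at hp
    have e : nodalGrad t p = affGrad (0 : Space d →ᵃ[ℝ] ℝ) := by
      rw [nodalGrad, Finset.sum_eq_zero fun i _ => if_neg (hp i)]
      simp [affGrad]
    rw [e]
    refine gradient_eq_of_eventuallyEq _ ?_
    filter_upwards [hO.mem_nhds hxO] with y hy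
    have : {r | ∃ t' ∈ 𝒯, ∃ j, t' j = p ∧ y ∈ body t' ∧ r = bary t' j y} = ∅ := by
      ext r
      simp only [Set.mem_ofPred_eq, Set.mem_empty_iff_false, iff_false]
      rintro ⟨t', ht', j, hj, hy', rfl⟩
      obtain rfl := hunique y hy t' ht' hy'
      exact hp j hj
    rw [nodalBasis, this, Real.sSup_empty]
    rfl

/-! ### The local form of the consistency error -/

/-- The contribution of the ordered pair of vertices `i`, `j` of the element `t` to the difference
of the exact and the scaled form, where `κ` is the coefficient on `t`. -/
noncomputable def pairError {d : ℕ} (κ v w : Space d → ℝ) (t : Simp d) (i j : Fin (d + 1)) : ℝ :=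
  1 / 2 * ((v (t i) - v (t j)) * (w (t j) - w (t i)) * ⟪affGrad (bary t i), affGrad (bary t j)⟫) *
    (∫ x in body t, κ x - (κ (t i) + κ (t j)) / 2)

/-- As the gradients of the barycentric coordinates sum to zero, the local stiffness matrix can be
expressed by differences of nodal values. -/
theorem inner_elemGrad {d : ℕ} {t : Simp d} (h : AffineIndependent ℝ t) (v w : Space d → ℝ) :
    ⟪elemGrad t v, elemGrad t w⟫ = ∑ i, ∑ j, 1 / 2 * ((v (t i) - v (t j)) * (w (t j) - w (t i)) *
      ⟪affGrad (bary t i), affGrad (bary t j)⟫) := by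
  set g := fun i => affGrad (bary t i) with hg
  have hg0 : ∑ i, g i = 0 := sum_affGrad_bary h
  have z1 : ∑ i, ∑ j, v (t i) * w (t i) * ⟪g i, g j⟫ = 0 := by
    refine Finset.sum_eq_zero fun i _ => ?_
    rw [← Finset.mul_sum, ← inner_sum, hg0, inner_zero_right, mul_zero]
  have z2 : ∑ i, ∑ j, v (t j) * w (t j) * ⟪g i, g j⟫ = 0 := by
    rw [Finset.sum_comm]
    refine Finset.sum_eq_zero fun j _ => ?_
    rw [← Finset.mul_sum, ← sum_inner, hg0, inner_zero_left, mul_zero]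
  have e1 : ⟪elemGrad t v, elemGrad t w⟫ = ∑ i, ∑ j, v (t i) * w (t j) * ⟪g i, g j⟫ := by
    rw [elemGrad, elemGrad, sum_inner]
    refine Finset.sum_congr rfl fun i _ => ?_
    rw [inner_sum]
    refine Finset.sum_congr rfl fun j _ => ?_
    rw [real_inner_smul_left, real_inner_smul_right]
    ring
  have e2 : ⟪elemGrad t v, elemGrad t w⟫ = ∑ i, ∑ j, v (t j) * w (t i) * ⟪g i, g j⟫ := by
    rw [e1, Finset.sum_comm]
    refine Finset.sum_congr rfl fun i _ => Finset.sum_congr rfl fun j _ => ?_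
    rw [real_inner_comm]
  have : ⟪elemGrad t v, elemGrad t w⟫ = 1 / 2 * (∑ i, ∑ j, v (t i) * w (t j) * ⟪g i, g j⟫
      + ∑ i, ∑ j, v (t j) * w (t i) * ⟪g i, g j⟫ - ∑ i, ∑ j, v (t i) * w (t i) * ⟪g i, g j⟫
      - ∑ i, ∑ j, v (t j) * w (t j) * ⟪g i, g j⟫) := by
    rw [← e1, ← e2, z1, z2]
    ring
  rw [this]
  simp only [← Finset.sum_add_distrib, ← Finset.sum_sub_distrib, Finset.mul_sum]
  refine Finset.sum_congr rfl fun i _ => Finset.sum_congr rfl fun j _ => ?_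
  ring

theorem sum_nodes_nodalGrad {d : ℕ} {𝒯 : Finset (Simp d)} {t : Simp d} (ht : t ∈ 𝒯)
    (X : Space d → Space d → ℝ) :
    ∑ p ∈ nodes 𝒯, ∑ q ∈ nodes 𝒯, X p q * ⟪nodalGrad t p, nodalGrad t q⟫ =
      ∑ i, ∑ j, X (t i) (t j) * ⟪affGrad (bary t i), affGrad (bary t j)⟫ := by
  classical
  have hmem : ∀ i, t i ∈ nodes 𝒯 := fun i =>
    Finset.mem_biUnion.2 ⟨t, ht, Finset.mem_image_of_mem _ (Finset.mem_univ i)⟩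
  have e : ∀ p q, X p q * ⟪nodalGrad t p, nodalGrad t q⟫ = ∑ i, ∑ j, if t i = p then
      if t j = q then X (t i) (t j) * ⟪affGrad (bary t i), affGrad (bary t j)⟫ else 0 else 0 := by
    intro p q
    rw [nodalGrad, nodalGrad, sum_inner, Finset.mul_sum]
    refine Finset.sum_congr rfl fun i _ => ?_
    rw [inner_sum, Finset.mul_sum]
    refine Finset.sum_congr rfl fun j _ => ?_
    by_cases h1 : t i = p <;> by_cases h2 : t j = q <;> simp [h1, h2]
  simp_rw [e]
  calc _ = ∑ p ∈ nodes 𝒯, ∑ i, ∑ j, ∑ q ∈ nodes 𝒯, (if t i = p then if t j = q then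
        X (t i) (t j) * ⟪affGrad (bary t i), affGrad (bary t j)⟫ else 0 else 0) := by
        refine Finset.sum_congr rfl fun p _ => ?_
        rw [Finset.sum_comm]
        exact Finset.sum_congr rfl fun i _ => Finset.sum_comm
    _ = ∑ i, ∑ j, ∑ p ∈ nodes 𝒯, ∑ q ∈ nodes 𝒯, (if t i = p then if t j = q then
        X (t i) (t j) * ⟪affGrad (bary t i), affGrad (bary t j)⟫ else 0 else 0) := by
        rw [Finset.sum_comm]
        exact Finset.sum_congr rfl fun i _ => Finset.sum_comm
    _ = _ := by
        refine Finset.sum_congr rfl fun i _ => Finset.sum_congr rfl fun j _ => ?_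
        rw [Finset.sum_eq_single (t i)]
        · simp [hmem j]
        · intro p _ hp
          simp [hp.symm]
        · exact fun h => absurd (hmem i) h

/-- The representative `kT T` may replace `k` in the integral over an element of `T`. -/
theorem exactForm_eq {d : ℕ} {𝒯 𝒯H : Finset (Simp d)} (hH : IsTiling 𝒯H) (h : IsTiling 𝒯)
    (hr : IsRefinementOf 𝒯 𝒯H) {k : Space d → ℝ} {kT : Simp d → Space d → ℝ}
    {gk : Space d → Space d} {Hk : Space d → Space d →L[ℝ] Space d}
    (hk : IsBrokenW2Infty 𝒯H k kT gk Hk) {v w : Space d → ℝ} (hv : IsFE 𝒯 v) (hw : IsFE 𝒯 w) :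
    exactForm (domain 𝒯H) k v w = ∑ T ∈ 𝒯H, ∑ t ∈ elementsIn 𝒯 T,
      ⟪elemGrad t v, elemGrad t w⟫ * ∫ x in body t, kT T x := by
  have key : ∀ T ∈ 𝒯H, ∀ t ∈ elementsIn 𝒯 T,
      (fun x => k x * ⟪gradient v x, gradient w x⟫) =ᵐ[volume.restrict (body t)]
        fun x => ⟪elemGrad t v, elemGrad t w⟫ * kT T x := by
    intro T hT t ht
    obtain ⟨ht, htT⟩ := mem_elementsIn.1 ht
    filter_upwards [ae_gradient_fe h hv ht, ae_gradient_fe h hw ht,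
      ae_restrict_of_ae_restrict_of_subset htT (hk.ae_eq T hT)] with x h1 h2 h3
    rw [h1, h2, h3, mul_comm]
  have hint : ∀ T ∈ 𝒯H, ∀ t ∈ elementsIn 𝒯 T,
      IntegrableOn (fun x => k x * ⟪gradient v x, gradient w x⟫) (body t) := by
    intro T hT t ht
    refine Integrable.congr ?_ (key T hT t ht).symm
    exact (((hk.continuousOn T hT).mono (mem_elementsIn.1 ht).2).integrableOn_compact
      (isCompact_body t)).const_mul _
  rw [exactForm, setIntegral_congr_set (domain_ae_eq 𝒯H), ← hr.1, h.setIntegral_region,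
    ← sum_elementsIn hH h hr]
  · refine Finset.sum_congr rfl fun T hT => Finset.sum_congr rfl fun t ht => ?_
    rw [integral_congr_ae (key T hT t ht), integral_const_mul]
  · intro t ht
    obtain ⟨T, hT, htT⟩ := hr.2 t ht
    exact hint T hT t (mem_elementsIn.2 ⟨ht, htT⟩)

theorem scaledForm_eq {d : ℕ} {𝒯 𝒯H : Finset (Simp d)} (hH : IsTiling 𝒯H) (h : IsTiling 𝒯)
    (hr : IsRefinementOf 𝒯 𝒯H) (kT : Simp d → Space d → ℝ) (v w : Space d → ℝ) :
    scaledForm 𝒯H 𝒯 kT v w = ∑ T ∈ 𝒯H, ∑ t ∈ elementsIn 𝒯 T, ∑ i, ∑ j,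
      1 / 2 * ((v (t i) - v (t j)) * (w (t j) - w (t i)) *
        ⟪affGrad (bary t i), affGrad (bary t j)⟫) *
        (volume.real (body t) * ((kT T (t i) + kT T (t j)) / 2)) := by
  rw [scaledForm, Finset.mul_sum]
  refine Finset.sum_congr rfl fun T hT => ?_
  have key : ∀ p q, ∀ t ∈ elementsIn 𝒯 T,
      (fun x => ⟪gradient (nodalBasis 𝒯 p) x, gradient (nodalBasis 𝒯 q) x⟫)
        =ᵐ[volume.restrict (body t)] fun _ => ⟪nodalGrad t p, nodalGrad t q⟫ := by
    intro p q t ht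
    have ht := elementsIn_subset _ _ ht
    filter_upwards [ae_gradient_nodalBasis h ht p, ae_gradient_nodalBasis h ht q] with x h1 h2
    rw [h1, h2]
  have hI : ∀ p q, ∫ x in body T, ⟪gradient (nodalBasis 𝒯 p) x, gradient (nodalBasis 𝒯 q) x⟫ =
      ∑ t ∈ elementsIn 𝒯 T, volume.real (body t) * ⟪nodalGrad t p, nodalGrad t q⟫ := by
    intro p q
    rw [setIntegral_macro hH h hr hT]
    · refine Finset.sum_congr rfl fun t ht => ?_
      rw [integral_congr_ae (key p q t ht), setIntegral_const, smul_eq_mul]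
    · intro t ht
      refine Integrable.congr ?_ (key p q t ht).symm
      exact integrableOn_const (volume_body_lt_top t).ne
  simp_rw [hI, Finset.mul_sum]
  simp_rw [← Finset.mul_sum (s := elementsIn 𝒯 T)]
  calc _ = ∑ p ∈ nodes 𝒯, ∑ t ∈ elementsIn 𝒯 T, ∑ q ∈ nodes 𝒯,
        1 / 4 * volume.real (body t) * ((kT T p + kT T q) * (v p - v q) * (w q - w p) *
          ⟪nodalGrad t p, nodalGrad t q⟫) := by
        refine Finset.sum_congr rfl fun p _ => ?_
        rw [Finset.sum_comm]
        refine Finset.sum_congr rfl fun q _ => ?_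
        rw [Finset.mul_sum, Finset.mul_sum]
        refine Finset.sum_congr rfl fun t _ => ?_
        ring
    _ = _ := by
        rw [Finset.sum_comm]
        refine Finset.sum_congr rfl fun t ht => ?_
        simp_rw [← Finset.mul_sum]
        rw [sum_nodes_nodalGrad (elementsIn_subset _ _ ht)
          (fun p q => (kT T p + kT T q) * (v p - v q) * (w q - w p)), Finset.mul_sum]
        refine Finset.sum_congr rfl fun i _ => ?_
        rw [Finset.mul_sum]
        refine Finset.sum_congr rfl fun j _ => ?_
        ring

/-- The consistency error is the sum of the contributions of all pairs of vertices of all elements,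
each weighted by the error of the trapezoidal rule on the corresponding edge. -/
theorem exactForm_sub_scaledForm {d : ℕ} {𝒯 𝒯H : Finset (Simp d)} (hH : IsTiling 𝒯H)
    (h : IsTiling 𝒯) (hr : IsRefinementOf 𝒯 𝒯H) {k : Space d → ℝ} {kT : Simp d → Space d → ℝ}
    {gk : Space d → Space d} {Hk : Space d → Space d →L[ℝ] Space d}
    (hk : IsBrokenW2Infty 𝒯H k kT gk Hk) {v w : Space d → ℝ} (hv : IsFE 𝒯 v) (hw : IsFE 𝒯 w) :
    exactForm (domain 𝒯H) k v w - scaledForm 𝒯H 𝒯 kT v w =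
      ∑ T ∈ 𝒯H, ∑ t ∈ elementsIn 𝒯 T, ∑ i, ∑ j, pairError (kT T) v w t i j := by
  rw [exactForm_eq hH h hr hk hv hw, scaledForm_eq hH h hr, ← Finset.sum_sub_distrib]
  refine Finset.sum_congr rfl fun T hT => ?_
  rw [← Finset.sum_sub_distrib]
  refine Finset.sum_congr rfl fun t ht => ?_
  obtain ⟨ht, htT⟩ := mem_elementsIn.1 ht
  rw [inner_elemGrad (h.nondegenerate t ht), Finset.sum_mul, ← Finset.sum_sub_distrib]
  refine Finset.sum_congr rfl fun i _ => ?_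
  rw [Finset.sum_mul, ← Finset.sum_sub_distrib]
  refine Finset.sum_congr rfl fun j _ => ?_
  rw [pairError, integral_sub, setIntegral_const, smul_eq_mul]
  · ring
  · exact ((hk.continuousOn T hT).mono htT).integrableOn_compact (isCompact_body t)
  · exact integrableOn_const (volume_body_lt_top t).ne

theorem gradNorm_eq_sqrt_sum {d : ℕ} {𝒯 : Finset (Simp d)} (h : IsTiling 𝒯) {v : Space d → ℝ}
    (hv : IsFE 𝒯 v) {𝒮 : Finset (Simp d)} (hs : 𝒮 ⊆ 𝒯) {S : Set (Space d)}
    (hS : S =ᵐ[volume] region 𝒮) :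
    gradNorm S v = Real.sqrt (∑ t ∈ 𝒮, volume.real (body t) * ‖elemGrad t v‖ ^ 2) := by
  have key : ∀ t ∈ 𝒮, (fun x => ‖gradient v x‖ ^ 2) =ᵐ[volume.restrict (body t)]
      fun _ => ‖elemGrad t v‖ ^ 2 := by
    intro t ht
    filter_upwards [ae_gradient_fe h hv (hs ht)] with x hx
    rw [hx]
  rw [gradNorm, setIntegral_congr_set hS, (h.subset hs).setIntegral_region]
  · congr 1
    refine Finset.sum_congr rfl fun t ht => ?_
    rw [integral_congr_ae (key t ht), setIntegral_const, smul_eq_mul]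
  · intro t ht
    exact Integrable.congr (integrableOn_const (volume_body_lt_top t).ne) (key t ht).symm

theorem sum_volume_mul_norm_le {d : ℕ} {𝒯 : Finset (Simp d)} (h : IsTiling 𝒯) {v w : Space d → ℝ}
    (hv : IsFE 𝒯 v) (hw : IsFE 𝒯 w) {𝒮 : Finset (Simp d)} (hs : 𝒮 ⊆ 𝒯) {S : Set (Space d)}
    (hS : S =ᵐ[volume] region 𝒮) :
    ∑ t ∈ 𝒮, volume.real (body t) * (‖elemGrad t v‖ * ‖elemGrad t w‖) ≤
      gradNorm S v * gradNorm S w := by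
  rw [gradNorm_eq_sqrt_sum h hv hs hS, gradNorm_eq_sqrt_sum h hw hs hS]
  have := Real.sum_mul_le_sqrt_mul_sqrt 𝒮
    (fun t => Real.sqrt (volume.real (body t)) * ‖elemGrad t v‖)
    (fun t => Real.sqrt (volume.real (body t)) * ‖elemGrad t w‖)
  simp only [mul_pow, Real.sq_sqrt measureReal_nonneg] at this
  refine le_trans (le_of_eq ?_) this
  refine Finset.sum_congr rfl fun t _ => ?_
  have := Real.mul_self_sqrt (measureReal_nonneg (μ := volume) (s := body t))
  linear_combination -(‖elemGrad t v‖ * ‖elemGrad t w‖) * this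

/-! ### The first-order bound -/

/-- The powers of the diameter that come from the differences of nodal values cancel those from the
gradients of the barycentric coordinates. -/
theorem abs_edgeWeight_le {d : ℕ} {𝒯 : Finset (Simp d)} (h : IsTiling 𝒯) {v w : Space d → ℝ}
    (hv : IsFE 𝒯 v) (hw : IsFE 𝒯 w) {t : Simp d} (ht : t ∈ 𝒯) {ρ : ℝ}
    (hρ : ∀ i, Metric.diam (body t) * ‖affGrad (bary t i)‖ ≤ ρ) (i j : Fin (d + 1)) :
    |(v (t i) - v (t j)) * (w (t j) - w (t i)) * ⟪affGrad (bary t i), affGrad (bary t j)⟫| ≤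
      ρ ^ 2 * (‖elemGrad t v‖ * ‖elemGrad t w‖) := by
  have hdiff : ∀ u : Space d → ℝ, IsFE 𝒯 u → ∀ i j,
      |u (t i) - u (t j)| ≤ ‖elemGrad t u‖ * Metric.diam (body t) := by
    intro u hu i j
    rw [← inner_elemGrad_sub h hu ht]
    refine (abs_real_inner_le_norm _ _).trans ?_
    gcongr
    exact norm_sub_le_diam_body t (vertex_mem_body t i) (vertex_mem_body t j)
  have hD : 0 ≤ Metric.diam (body t) := Metric.diam_nonneg
  have hρ0 : 0 ≤ ρ := (mul_nonneg hD (norm_nonneg _)).trans (hρ i)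
  rw [abs_mul, abs_mul]
  calc _ ≤ (‖elemGrad t v‖ * Metric.diam (body t)) * (‖elemGrad t w‖ * Metric.diam (body t)) *
        (‖affGrad (bary t i)‖ * ‖affGrad (bary t j)‖) := by
        gcongr
        · exact hdiff v hv i j
        · exact hdiff w hw j i
        · exact abs_real_inner_le_norm _ _
    _ = (Metric.diam (body t) * ‖affGrad (bary t i)‖) *
        (Metric.diam (body t) * ‖affGrad (bary t j)‖) *
        (‖elemGrad t v‖ * ‖elemGrad t w‖) := by ring
    _ ≤ ρ * ρ * (‖elemGrad t v‖ * ‖elemGrad t w‖) := by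
        gcongr
        · exact hρ i
        · exact hρ j
    _ = _ := by ring

theorem abs_pairError_le {d : ℕ} {𝒯 : Finset (Simp d)} (h : IsTiling 𝒯) {v w : Space d → ℝ}
    (hv : IsFE 𝒯 v) (hw : IsFE 𝒯 w) {t : Simp d} (ht : t ∈ 𝒯) {ρ : ℝ}
    (hρ : ∀ i, Metric.diam (body t) * ‖affGrad (bary t i)‖ ≤ ρ) {δ : ℝ}
    (hδ : Metric.diam (body t) ≤ δ) {κ : Space d → ℝ} {L : ℝ} (hL : 0 ≤ L)
    (hκ : ∀ x ∈ body t, ∀ y ∈ body t, |κ x - κ y| ≤ L * ‖x - y‖) (i j : Fin (d + 1)) :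
    |pairError κ v w t i j| ≤ 1 / 2 * ρ ^ 2 * (δ * L) *
      (volume.real (body t) * (‖elemGrad t v‖ * ‖elemGrad t w‖)) := by
  have h1 : |∫ x in body t, κ x - (κ (t i) + κ (t j)) / 2| ≤
      δ * L * volume.real (body t) := by
    rw [← Real.norm_eq_abs]
    refine norm_setIntegral_le_of_norm_le_const (volume_body_lt_top t) fun x hx => ?_
    have b : ∀ i, |κ x - κ (t i)| ≤ δ * L := fun i => by
      refine (hκ x hx _ (vertex_mem_body t i)).trans ?_
      rw [mul_comm]
      gcongr
      exact (norm_sub_le_diam_body t hx (vertex_mem_body t i)).trans hδ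
    have b1 := abs_le.1 (b i)
    have b2 := abs_le.1 (b j)
    rw [Real.norm_eq_abs, abs_le]
    constructor <;> linarith [b1.1, b1.2, b2.1, b2.2]
  rw [pairError, abs_mul, abs_mul, abs_of_pos (by norm_num : (0 : ℝ) < 1 / 2)]
  calc _ ≤ 1 / 2 * (ρ ^ 2 * (‖elemGrad t v‖ * ‖elemGrad t w‖)) *
        (δ * L * volume.real (body t)) := by
        gcongr
        exact abs_edgeWeight_le h hv hw ht hρ i j
    _ = _ := by ring

theorem IsBrokenW2Infty.lipschitz {d : ℕ} {𝒯H : Finset (Simp d)} (hH : IsTiling 𝒯H)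
    {k : Space d → ℝ} {kT : Simp d → Space d → ℝ}
    {gk : Space d → Space d} {Hk : Space d → Space d →L[ℝ] Space d}
    (hk : IsBrokenW2Infty 𝒯H k kT gk Hk) {T : Simp d} (hT : T ∈ 𝒯H) {x y : Space d}
    (hx : x ∈ body T) (hy : y ∈ body T) :
    |kT T x - kT T y| ≤ brokenSupNorm 𝒯H gk * ‖x - y‖ :=
  coeff_lipschitz (hH.nondegenerate T hT) (hk.w2infty T hT) (hk.continuousOn T hT)
    (hk.ae_eq T hT) ENNReal.toReal_nonneg
    (ae_norm_le_brokenSupNorm (fun S hS => by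
      rw [← restrict_interior_body]
      exact (hk.w2infty S hS).memLp_grad) hT) hx hy

theorem IsBrokenW2Infty.second_difference {d : ℕ} {𝒯H : Finset (Simp d)} (hH : IsTiling 𝒯H)
    {k : Space d → ℝ} {kT : Simp d → Space d → ℝ}
    {gk : Space d → Space d} {Hk : Space d → Space d →L[ℝ] Space d}
    (hk : IsBrokenW2Infty 𝒯H k kT gk Hk) {T : Simp d} (hT : T ∈ 𝒯H) {m z : Space d}
    (hp : m + z ∈ body T) (hn : m - z ∈ body T) :
    |kT T (m + z) + kT T (m - z) - 2 * kT T m| ≤ 2 * brokenSupNorm 𝒯H Hk * ‖z‖ ^ 2 :=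
  coeff_second_difference (hH.nondegenerate T hT) (hk.w2infty T hT) (hk.continuousOn T hT)
    (hk.ae_eq T hT) ENNReal.toReal_nonneg
    (ae_norm_le_brokenSupNorm (fun S hS => by
      rw [← restrict_interior_body]
      exact (hk.w2infty S hS).memLp_hess) hT) hp hn

theorem sum_pairs_const {d : ℕ} (c : ℝ) :
    ∑ _i : Fin (d + 1), ∑ _j : Fin (d + 1), c = (d + 1) ^ 2 * c := by
  simp
  ring

/-- The first-order bound on a shape-regular mesh: `ρ` is the shape regularity constant, and `δ`
bounds the diameters of the elements. -/
theorem first_order_bound {d : ℕ} {𝒯 𝒯H : Finset (Simp d)} (hH : IsTiling 𝒯H) (h : IsTiling 𝒯)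
    (hr : IsRefinementOf 𝒯 𝒯H) {ρ δ : ℝ}
    (hρ : ∀ t ∈ 𝒯, ∀ i, Metric.diam (body t) * ‖affGrad (bary t i)‖ ≤ ρ)
    (hδ : ∀ t ∈ 𝒯, Metric.diam (body t) ≤ δ) (hδ0 : 0 ≤ δ)
    {k : Space d → ℝ} {kT : Simp d → Space d → ℝ}
    {gk : Space d → Space d} {Hk : Space d → Space d →L[ℝ] Space d}
    (hk : IsBrokenW2Infty 𝒯H k kT gk Hk) {v w : Space d → ℝ} (hv : IsFE 𝒯 v) (hw : IsFE 𝒯 w) :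
    |exactForm (domain 𝒯H) k v w - scaledForm 𝒯H 𝒯 kT v w| ≤
      (d + 1) ^ 2 * ρ ^ 2 * δ * brokenSupNorm 𝒯H gk *
        gradNorm (domain 𝒯H) v * gradNorm (domain 𝒯H) w := by
  set L := brokenSupNorm 𝒯H gk with hL
  have hL0 : 0 ≤ L := ENNReal.toReal_nonneg
  have hdom : domain 𝒯H =ᵐ[volume] region 𝒯 := by
    rw [hr.1]
    exact domain_ae_eq 𝒯H
  rw [exactForm_sub_scaledForm hH h hr hk hv hw]
  calc _ ≤ ∑ T ∈ 𝒯H, ∑ t ∈ elementsIn 𝒯 T, (d + 1) ^ 2 * (1 / 2 * ρ ^ 2 * (δ * L)) *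
        (volume.real (body t) * (‖elemGrad t v‖ * ‖elemGrad t w‖)) := by
        refine (Finset.abs_sum_le_sum_abs _ _).trans (Finset.sum_le_sum fun T hT => ?_)
        refine (Finset.abs_sum_le_sum_abs _ _).trans (Finset.sum_le_sum fun t ht => ?_)
        obtain ⟨ht, htT⟩ := mem_elementsIn.1 ht
        rw [mul_assoc, ← sum_pairs_const]
        refine (Finset.abs_sum_le_sum_abs _ _).trans (Finset.sum_le_sum fun i _ => ?_)
        refine (Finset.abs_sum_le_sum_abs _ _).trans (Finset.sum_le_sum fun j _ => ?_)
        exact abs_pairError_le h hv hw ht (hρ t ht) (hδ t ht) hL0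
          (fun x hx y hy => hk.lipschitz hH hT (htT hx) (htT hy)) i j
    _ = (d + 1) ^ 2 * (1 / 2 * ρ ^ 2 * (δ * L)) * ∑ t ∈ 𝒯,
        (volume.real (body t) * (‖elemGrad t v‖ * ‖elemGrad t w‖)) := by
        rw [sum_elementsIn hH h hr, Finset.mul_sum]
    _ ≤ (d + 1) ^ 2 * (1 * ρ ^ 2 * (δ * L)) *
        (gradNorm (domain 𝒯H) v * gradNorm (domain 𝒯H) w) := by
        gcongr
        · norm_num
        · exact sum_volume_mul_norm_le h hv hw subset_rfl hdom
    _ = _ := by ring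

/-! ### Reflection of elements about edge midpoints -/

/-- The image of the simplex `t` under the reflection about the midpoint of its edge from `t i` to
`t j`, with the reversed numbering of the vertices. -/
def reflect {d : ℕ} (t : Simp d) (i j : Fin (d + 1)) : Simp d :=
  fun k => t i + t j - t (Fin.rev k)

theorem reflect_rev {d : ℕ} (t : Simp d) (i j k : Fin (d + 1)) :
    reflect t i j (Fin.rev k) = t i + t j - t k := by
  simp [reflect]

theorem reflect_reflect {d : ℕ} (t : Simp d) (i j : Fin (d + 1)) :
    reflect (reflect t i j) (Fin.rev j) (Fin.rev i) = t := by
  ext1 k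
  rw [reflect, reflect_rev, reflect_rev, reflect_rev]
  module

theorem mem_body_reflect {d : ℕ} (t : Simp d) (i j : Fin (d + 1)) (x : Space d) :
    t i + t j - x ∈ body (reflect t i j) ↔ x ∈ body t := by
  let f : Space d ≃ᵃ[ℝ] Space d := AffineEquiv.constVSub ℝ (t i + t j)
  have hf : ∀ y, f y = t i + t j - y := fun y => rfl
  have e : body (reflect t i j) = f '' body t := by
    rw [body, body]
    refine Eq.trans ?_ (f.toAffineMap.image_convexHull (Set.range t)).symm
    congr 1
    ext y
    constructor
    · rintro ⟨k, rfl⟩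
      exact ⟨t (Fin.rev k), ⟨_, rfl⟩, rfl⟩
    · rintro ⟨_, ⟨k, rfl⟩, rfl⟩
      exact ⟨Fin.rev k, reflect_rev t i j k⟩
  rw [e, ← hf, f.injective.mem_set_image]

theorem bary_reflect {d : ℕ} {t : Simp d} {i j : Fin (d + 1)} (ht : AffineIndependent ℝ t)
    (ht' : AffineIndependent ℝ (reflect t i j)) (k : Fin (d + 1)) (x : Space d) :
    bary (reflect t i j) (Fin.rev k) x = bary t k (t i + t j - x) := by
  let A : Space d →ᵃ[ℝ] ℝ :=
    (bary t k).comp (AffineEquiv.constVSub ℝ (t i + t j) : Space d ≃ᵃ[ℝ] Space d).toAffineMap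
  have hA : ∀ y, A y = bary t k (t i + t j - y) := fun y => rfl
  rw [← hA, affine_eq_sum_bary ht' A x, Finset.sum_eq_single (Fin.rev k)]
  · rw [hA, reflect_rev, sub_sub_cancel, bary_vertex ht, if_pos rfl, one_mul]
  · intro m _ hm
    rw [hA, reflect, sub_sub_cancel, bary_vertex ht, if_neg, zero_mul]
    rintro rfl
    exact hm (Fin.rev_rev m).symm
  · simp

theorem affGrad_bary_reflect {d : ℕ} {t : Simp d} {i j : Fin (d + 1)} (ht : AffineIndependent ℝ t)
    (ht' : AffineIndependent ℝ (reflect t i j)) (k : Fin (d + 1)) :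
    affGrad (bary (reflect t i j) (Fin.rev k)) = -affGrad (bary t k) := by
  refine ext_inner_right ℝ fun u => ?_
  have hu : u = u - 0 := by simp
  rw [hu, inner_affGrad_sub, bary_reflect ht ht', bary_reflect ht ht', ← inner_affGrad_sub,
    inner_neg_left, ← inner_neg_right]
  congr 1
  module

theorem setIntegral_reflect {d : ℕ} (t : Simp d) (i j : Fin (d + 1)) (f : Space d → ℝ) :
    ∫ x in body (reflect t i j), f x = ∫ x in body t, f (t i + t j - x) := by
  have hpre : (fun x => t i + t j - x) ⁻¹' body (reflect t i j) = body t := by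
    ext x
    exact mem_body_reflect t i j x
  rw [← hpre]
  exact ((Measure.measurePreserving_sub_left volume (t i + t j)).setIntegral_preimage_emb
    (Homeomorph.subLeft (t i + t j)).measurableEmbedding f _).symm

/-- On an element and its reflection the first-order parts of the two errors that belong to the
common edge cancel, and only a second difference of the coefficient is left. -/
theorem abs_pairError_add_reflect_le {d : ℕ} {𝒯 : Finset (Simp d)} (h : IsTiling 𝒯)
    {v w : Space d → ℝ} (hv : IsFE 𝒯 v) (hw : IsFE 𝒯 w) {t T : Simp d} {i j : Fin (d + 1)}
    (ht : t ∈ elementsIn 𝒯 T) (ht' : reflect t i j ∈ elementsIn 𝒯 T) {ρ : ℝ}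
    (hρ : ∀ i, Metric.diam (body t) * ‖affGrad (bary t i)‖ ≤ ρ) {δ : ℝ}
    (hδ : Metric.diam (body t) ≤ δ) {κ : Space d → ℝ} (hc : ContinuousOn κ (body T)) {M : ℝ}
    (hM : 0 ≤ M) (hκ : ∀ m z, m + z ∈ body T → m - z ∈ body T →
      |κ (m + z) + κ (m - z) - 2 * κ m| ≤ 2 * M * ‖z‖ ^ 2) :
    |pairError κ v w t i j + pairError κ v w (reflect t i j) (Fin.rev j) (Fin.rev i)| ≤
      2 * ρ ^ 2 * (δ ^ 2 * M) *
        (volume.real (body t) * (‖elemGrad t v‖ * ‖elemGrad t w‖)) := by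
  obtain ⟨ht, htT⟩ := mem_elementsIn.1 ht
  obtain ⟨ht', htT'⟩ := mem_elementsIn.1 ht'
  have n := h.nondegenerate t ht
  have n' := h.nondegenerate _ ht'
  have e1 : reflect t i j (Fin.rev j) = t i := by rw [reflect_rev]; module
  have e2 : reflect t i j (Fin.rev i) = t j := by rw [reflect_rev]; module
  have hi := vertex_mem_body t i
  have hj := vertex_mem_body t j
  set m : Space d := (1 / 2 : ℝ) • t i + (1 / 2 : ℝ) • t j with hm
  have hmt : m ∈ body t := (convex_body t) hi hj (by norm_num) (by norm_num) (by norm_num)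
  have hpt : ∀ x ∈ body t, |κ x + κ (t i + t j - x) - 2 * κ m| ≤ 2 * M * δ ^ 2 := by
    intro x hx
    have a1 : m + (x - m) = x := by module
    have a2 : m - (x - m) = t i + t j - x := by rw [hm]; module
    have := hκ m (x - m) (by rw [a1]; exact htT hx)
      (by rw [a2]; exact htT' ((mem_body_reflect t i j x).2 hx))
    rw [a1, a2] at this
    refine this.trans ?_
    gcongr
    exact (norm_sub_le_diam_body t hx hmt).trans hδ
  have hp2 : |κ (t i) + κ (t j) - 2 * κ m| ≤ 2 * M * δ ^ 2 := by
    have := hpt _ hi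
    rwa [add_sub_cancel_left] at this
  have c1 : IntegrableOn κ (body t) := (hc.mono htT).integrableOn_compact (isCompact_body t)
  have c2 : IntegrableOn (fun x => κ (t i + t j - x)) (body t) := by
    refine ContinuousOn.integrableOn_compact (isCompact_body t) ?_
    exact hc.comp (by fun_prop) fun x hx => htT' ((mem_body_reflect t i j x).2 hx)
  have c3 : ∀ c : ℝ, IntegrableOn (fun _ => c) (body t) := fun c =>
    integrableOn_const (volume_body_lt_top t).ne
  have hint : |(∫ x in body t, κ x - (κ (t i) + κ (t j)) / 2) +
      ∫ x in body (reflect t i j), κ x - (κ (t i) + κ (t j)) / 2| ≤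
      4 * M * δ ^ 2 * volume.real (body t) := by
    have a1 : Integrable (fun x => κ x - (κ (t i) + κ (t j)) / 2) (volume.restrict (body t)) :=
      c1.sub (c3 _)
    have a2 : Integrable (fun x => κ (t i + t j - x) - (κ (t i) + κ (t j)) / 2)
        (volume.restrict (body t)) := c2.sub (c3 _)
    rw [setIntegral_reflect, ← integral_add a1 a2, ← Real.norm_eq_abs]
    refine norm_setIntegral_le_of_norm_le_const (volume_body_lt_top t) fun x hx => ?_
    have b1 := abs_le.1 (hpt x hx)
    have b2 := abs_le.1 hp2
    rw [Real.norm_eq_abs, abs_le]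
    constructor <;> linarith [b1.1, b1.2, b2.1, b2.2]
  have hsum : pairError κ v w t i j + pairError κ v w (reflect t i j) (Fin.rev j) (Fin.rev i) =
      1 / 2 * ((v (t i) - v (t j)) * (w (t j) - w (t i)) *
        ⟪affGrad (bary t i), affGrad (bary t j)⟫) *
      ((∫ x in body t, κ x - (κ (t i) + κ (t j)) / 2) +
      ∫ x in body (reflect t i j), κ x - (κ (t i) + κ (t j)) / 2) := by
    rw [pairError, pairError, affGrad_bary_reflect n n', affGrad_bary_reflect n n', e1, e2,
      inner_neg_neg, real_inner_comm (affGrad (bary t i))]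
    ring
  rw [hsum, abs_mul, abs_mul, abs_of_pos (by norm_num : (0 : ℝ) < 1 / 2)]
  calc _ ≤ 1 / 2 * (ρ ^ 2 * (‖elemGrad t v‖ * ‖elemGrad t w‖)) *
        (4 * M * δ ^ 2 * volume.real (body t)) := by
        gcongr
        exact abs_edgeWeight_le h hv hw ht hρ i j
    _ = _ := by ring

/-! ### The second-order bound -/

open Classical in
/-- The elements that make up the strip `S_h`. -/
noncomputable def stripElements {d : ℕ} (𝒯H 𝒯 : Finset (Simp d)) : Finset (Simp d) :=
  𝒯.filter fun t => ∃ T ∈ 𝒯H, (frontier (body t) ∩ frontier (body T)).Nonempty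

theorem strip_eq_region {d : ℕ} (𝒯H 𝒯 : Finset (Simp d)) :
    strip 𝒯H 𝒯 = region (stripElements 𝒯H 𝒯) := by
  classical
  ext x
  simp only [strip, region, stripElements, Set.mem_iUnion, Finset.mem_filter, exists_prop]
  constructor
  · rintro ⟨T, hT, t, ht, hn, hx⟩
    exact ⟨t, ⟨ht, T, hT, hn⟩, hx⟩
  · rintro ⟨t, ⟨ht, T, hT, hn⟩, hx⟩
    exact ⟨T, hT, t, ht, hn, hx⟩

/-- A sum over a finite set does not change if the summands are averaged along an involution of a
part of the index set. -/
theorem sum_eq_sum_average {α : Type*} [DecidableEq α] (I : Finset α) (good : α → Prop)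
    [DecidablePred good] (σ : α → α) (hσ : ∀ x ∈ I, good x → σ x ∈ I ∧ good (σ x))
    (hσσ : ∀ x, σ (σ x) = x) (f : α → ℝ) :
    ∑ x ∈ I, f x = ∑ x ∈ I, if good x then 1 / 2 * (f x + f (σ x)) else f x := by
  have h1 : ∑ x ∈ I.filter good, f x = ∑ x ∈ I.filter good, f (σ x) := by
    have hmem : ∀ x ∈ I.filter good, σ x ∈ I.filter good := fun x hx => by
      rw [Finset.mem_filter] at hx ⊢
      exact hσ x hx.1 hx.2
    exact Finset.sum_nbij' σ σ hmem hmem (fun x _ => hσσ x) (fun x _ => hσσ x)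
      (fun x _ => by rw [hσσ])
  rw [Finset.sum_ite, ← Finset.sum_filter_add_sum_filter_not I good f, ← Finset.mul_sum,
    Finset.sum_add_distrib, ← h1]
  ring

/-- The second-order bound on a shape-regular mesh which is locally invariant under reflections:
elements which do not touch the boundary of their macro element can be reflected within it. -/
theorem second_order_bound {d : ℕ} {𝒯 𝒯H : Finset (Simp d)} (hH : IsTiling 𝒯H) (h : IsTiling 𝒯)
    (hr : IsRefinementOf 𝒯 𝒯H) {ρ δ : ℝ}
    (hρ : ∀ t ∈ 𝒯, ∀ i, Metric.diam (body t) * ‖affGrad (bary t i)‖ ≤ ρ)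
    (hδ : ∀ t ∈ 𝒯, Metric.diam (body t) ≤ δ) (hδ0 : 0 ≤ δ)
    (hsym : ∀ T ∈ 𝒯H, ∀ t ∈ elementsIn 𝒯 T, frontier (body t) ∩ frontier (body T) = ∅ →
      ∀ i j, reflect t i j ∈ elementsIn 𝒯 T)
    {k : Space d → ℝ} {kT : Simp d → Space d → ℝ}
    {gk : Space d → Space d} {Hk : Space d → Space d →L[ℝ] Space d}
    (hk : IsBrokenW2Infty 𝒯H k kT gk Hk) {v w : Space d → ℝ} (hv : IsFE 𝒯 v) (hw : IsFE 𝒯 w) :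
    |exactForm (domain 𝒯H) k v w - scaledForm 𝒯H 𝒯 kT v w| ≤
      (d + 1) ^ 2 * ρ ^ 2 * (δ ^ 2 * brokenSupNorm 𝒯H Hk *
          gradNorm (domain 𝒯H) v * gradNorm (domain 𝒯H) w +
        δ * brokenSupNorm 𝒯H gk * gradNorm (strip 𝒯H 𝒯) v * gradNorm (strip 𝒯H 𝒯) w) := by
  classical
  set L := brokenSupNorm 𝒯H gk with hL
  set M := brokenSupNorm 𝒯H Hk with hM
  have hL0 : 0 ≤ L := ENNReal.toReal_nonneg
  have hM0 : 0 ≤ M := ENNReal.toReal_nonneg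
  have hdom : domain 𝒯H =ᵐ[volume] region 𝒯 := by
    rw [hr.1]
    exact domain_ae_eq 𝒯H
  set E : Simp d → ℝ := fun t => volume.real (body t) * (‖elemGrad t v‖ * ‖elemGrad t w‖) with hE
  have hsub : stripElements 𝒯H 𝒯 ⊆ 𝒯 := Finset.filter_subset _ _
  have hE0 : ∀ t, 0 ≤ E t := fun t => mul_nonneg measureReal_nonneg (by positivity)
  have h_local : ∀ T ∈ 𝒯H, |∑ t ∈ elementsIn 𝒯 T, ∑ i, ∑ j, pairError (kT T) v w t i j| ≤
      ∑ t ∈ elementsIn 𝒯 T, (d + 1) ^ 2 * (ρ ^ 2 * (δ ^ 2 * M) * E t +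
        if t ∈ stripElements 𝒯H 𝒯 then ρ ^ 2 * (δ * L) * E t else 0) := by
    intro T hT
    have hprod : ∀ f : Simp d → Fin (d + 1) → Fin (d + 1) → ℝ,
        ∑ t ∈ elementsIn 𝒯 T, ∑ i, ∑ j, f t i j =
          ∑ x ∈ elementsIn 𝒯 T ×ˢ (Finset.univ : Finset (Fin (d + 1) × Fin (d + 1))),
            f x.1 x.2.1 x.2.2 := by
      intro f
      rw [Finset.sum_product]
      refine Finset.sum_congr rfl fun t _ => ?_
      rw [Fintype.sum_prod_type]
    simp_rw [← sum_pairs_const]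
    rw [hprod, hprod]
    rw [sum_eq_sum_average _ (fun x => reflect x.1 x.2.1 x.2.2 ∈ elementsIn 𝒯 T)
      (fun x => (reflect x.1 x.2.1 x.2.2, Fin.rev x.2.2, Fin.rev x.2.1))]
    · refine (Finset.abs_sum_le_sum_abs _ _).trans (Finset.sum_le_sum ?_)
      rintro ⟨t, i, j⟩ hx
      have htT : t ∈ elementsIn 𝒯 T := (Finset.mem_product.1 hx).1
      have ht : t ∈ 𝒯 := elementsIn_subset _ _ htT
      dsimp only
      split_ifs with h1 h2 h2
      · have := abs_pairError_add_reflect_le h hv hw htT h1 (hρ t ht) (hδ t ht)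
          (hk.continuousOn T hT) hM0 (fun m z hp hn => hk.second_difference hH hT hp hn)
        rw [abs_mul, abs_of_pos (by norm_num : (0 : ℝ) < 1 / 2)]
        have : 0 ≤ ρ ^ 2 * (δ * L) * E t := mul_nonneg (by positivity) (hE0 t)
        simp only [hE] at *
        linarith
      · have := abs_pairError_add_reflect_le h hv hw htT h1 (hρ t ht) (hδ t ht)
          (hk.continuousOn T hT) hM0 (fun m z hp hn => hk.second_difference hH hT hp hn)
        rw [abs_mul, abs_of_pos (by norm_num : (0 : ℝ) < 1 / 2)]
        simp only [hE] at *
        linarith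
      · have := abs_pairError_le h hv hw ht (hρ t ht) (hδ t ht) hL0
          (fun x hx y hy => hk.lipschitz hH hT ((mem_elementsIn.1 htT).2 hx)
            ((mem_elementsIn.1 htT).2 hy)) i j
        have h3 : 0 ≤ ρ ^ 2 * (δ * L) * E t := mul_nonneg (by positivity) (hE0 t)
        have h4 : 0 ≤ ρ ^ 2 * (δ ^ 2 * M) * E t := mul_nonneg (by positivity) (hE0 t)
        simp only [hE] at *
        linarith
      · refine absurd (hsym T hT t htT ?_ i j) h1
        by_contra hne
        exact h2 (Finset.mem_filter.2 ⟨ht, T, hT, Set.nonempty_iff_ne_empty.2 hne⟩)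
    · rintro ⟨t, i, j⟩ hx h1
      refine ⟨Finset.mem_product.2 ⟨h1, Finset.mem_univ _⟩, ?_⟩
      dsimp only
      rw [reflect_reflect]
      exact (Finset.mem_product.1 hx).1
    · rintro ⟨t, i, j⟩
      simp [reflect_reflect]
  rw [exactForm_sub_scaledForm hH h hr hk hv hw]
  calc _ ≤ ∑ T ∈ 𝒯H, ∑ t ∈ elementsIn 𝒯 T, (d + 1) ^ 2 * (ρ ^ 2 * (δ ^ 2 * M) * E t +
        if t ∈ stripElements 𝒯H 𝒯 then ρ ^ 2 * (δ * L) * E t else 0) :=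
        (Finset.abs_sum_le_sum_abs _ _).trans (Finset.sum_le_sum h_local)
    _ = (d + 1) ^ 2 * (ρ ^ 2 * (δ ^ 2 * M) * ∑ t ∈ 𝒯, E t +
        ρ ^ 2 * (δ * L) * ∑ t ∈ stripElements 𝒯H 𝒯, E t) := by
        rw [sum_elementsIn hH h hr, ← Finset.mul_sum, Finset.sum_add_distrib, ← Finset.mul_sum,
          ← Finset.sum_filter, ← Finset.mul_sum, Finset.filter_mem_eq_inter,
          Finset.inter_eq_right.2 hsub]
    _ ≤ (d + 1) ^ 2 * (ρ ^ 2 * (δ ^ 2 * M) *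
          (gradNorm (domain 𝒯H) v * gradNorm (domain 𝒯H) w) +
        ρ ^ 2 * (δ * L) * (gradNorm (strip 𝒯H 𝒯) v * gradNorm (strip 𝒯H 𝒯) w)) := by
        gcongr
        · exact sum_volume_mul_norm_le h hv hw subset_rfl hdom
        · refine sum_volume_mul_norm_le h hv hw hsub ?_
          exact (strip_eq_region 𝒯H 𝒯).eventuallyEq
    _ = _ := by ring

/-! ### The refinement rule in lattice coordinates -/

/-- In the coordinates `x = x₀ + ∑ₙ yₙ (xₙ₊₁ - xₙ)` with respect to a simplex with vertices
`x₀, …, x_d`, the vertex `x_k` has the coordinates `yₙ = 1` for `n < k` and `yₙ = 0` otherwise. -/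
def vertexStep {d : ℕ} (n : Fin d) (k : Fin (d + 1)) : ℕ := if n.castSucc < k then 1 else 0

/-- In doubled lattice coordinates, each child is a lattice translate of the parent with permuted
coordinate axes. -/
theorem childTable_eq_permuted {d : ℕ} (hd : d = 2 ∨ d = 3) :
    ∀ s ∈ childTable d, ∃ r : Equiv.Perm (Fin d), ∀ n k,
      vertexStep n (s k).1 + vertexStep n (s k).2 =
        vertexStep n (s 0).1 + vertexStep n (s 0).2 + vertexStep (r n) k := by
  rcases hd with rfl | rfl
  · simp only [childTable, List.forall_mem_cons, List.not_mem_nil, IsEmpty.forall_iff,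
      implies_true, and_true]
    refine ⟨⟨1, ?_⟩, ⟨1, ?_⟩, ⟨1, ?_⟩, ⟨Equiv.swap 0 1, ?_⟩⟩ <;> decide
  · simp only [childTable, List.forall_mem_cons, List.not_mem_nil, IsEmpty.forall_iff,
      implies_true, and_true]
    refine ⟨⟨1, ?_⟩, ⟨1, ?_⟩, ⟨1, ?_⟩, ⟨1, ?_⟩, ⟨finRotate 3 ^ 2, ?_⟩, ⟨Equiv.swap 0 1, ?_⟩,
      ⟨finRotate 3, ?_⟩, ⟨Equiv.swap 1 2, ?_⟩⟩ <;> decide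

set_option maxRecDepth 100000 in
/-- For each parity vector `ε` of the base point, the lattice simplex with base point `ε` and
unpermuted axes is a child of a lattice simplex at the origin. -/
theorem exists_mem_childTable {d : ℕ} (hd : d = 2 ∨ d = 3) :
    ∀ ε : Fin d → Fin 2, ∃ s ∈ childTable d, ∃ q : Equiv.Perm (Fin d), ∀ n k,
      vertexStep (q n) (s k).1 + vertexStep (q n) (s k).2 = (ε n : ℕ) + vertexStep n k := by
  rcases hd with rfl | rfl
  · decide
  · decide

/-- The `k`-th vertex of the Freudenthal simplex with base point `z` and ordering `q` of the
coordinate axes: starting from `z`, the axis `m` is the `q m`-th one along which a unit step is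
made. -/
def latticeVertex {d : ℕ} (z : Fin d → ℤ) (q : Equiv.Perm (Fin d)) (k : Fin (d + 1)) :
    Fin d → ℤ :=
  fun m => z m + vertexStep (q m) k

/-- The barycentric coordinates, multiplied by `N`, of the point with lattice coordinates `y` in the
`N`-fold subdivided simplex: the differences of consecutive members of `N, y₀, …, y_{d-1}, 0`. -/
def latticeBary {d : ℕ} (N : ℤ) (y : Fin d → ℤ) (k : Fin (d + 1)) : ℤ :=
  (Fin.cons N y : Fin (d + 1) → ℤ) k - (Fin.snoc y 0 : Fin (d + 1) → ℤ) k

/-- The point with lattice coordinates `y` in the `N`-fold subdivided simplex `T`. -/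
noncomputable def latticePoint {d : ℕ} (T : Simp d) (N : ℤ) (y : Fin d → ℤ) : Space d :=
  ∑ k, ((latticeBary N y k : ℝ) / N) • T k

/-- `t` is one of the Freudenthal simplices of the `N`-fold subdivision of `T`. -/
def IsLatticeSimplex {d : ℕ} (T : Simp d) (N : ℤ) (t : Simp d) : Prop :=
  ∃ (z : Fin d → ℤ) (q : Equiv.Perm (Fin d)), ∀ k,
    (∀ m, 0 ≤ latticeBary N (latticeVertex z q k) m) ∧
      t k = latticePoint T N (latticeVertex z q k)

theorem sum_latticeBary {d : ℕ} (N : ℤ) (y : Fin d → ℤ) : ∑ k, latticeBary N y k = N := by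
  simp only [latticeBary, Finset.sum_sub_distrib]
  rw [Fin.sum_univ_succ, Fin.sum_univ_castSucc]
  simp

theorem latticeBary_add {d : ℕ} (N N' : ℤ) (y y' : Fin d → ℤ) (k : Fin (d + 1)) :
    latticeBary (N + N') (y + y') k = latticeBary N y k + latticeBary N' y' k := by
  have h1 : (Fin.cons (N + N') (y + y') : Fin (d + 1) → ℤ) k =
      (Fin.cons N y : Fin (d + 1) → ℤ) k + (Fin.cons N' y' : Fin (d + 1) → ℤ) k := by
    refine Fin.cases ?_ (fun a => ?_) k <;> simp
  have h2 : (Fin.snoc (y + y') 0 : Fin (d + 1) → ℤ) k =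
      (Fin.snoc y 0 : Fin (d + 1) → ℤ) k + (Fin.snoc y' 0 : Fin (d + 1) → ℤ) k := by
    refine Fin.lastCases ?_ (fun a => ?_) k <;> simp
  simp only [latticeBary, h1, h2]
  ring

theorem latticeBary_single {d : ℕ} (a : Fin d) (k : Fin (d + 1)) :
    latticeBary 0 (Pi.single a 1) k =
      (if k = a.succ then 1 else 0) - (if k = a.castSucc then 1 else 0) := by
  have h1 : (Fin.cons 0 (Pi.single a 1) : Fin (d + 1) → ℤ) k = if k = a.succ then 1 else 0 := by
    refine Fin.cases ?_ (fun b => ?_) k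
    · simp [(Fin.succ_ne_zero a).symm]
    · simp [Pi.single_apply]
  have h2 : (Fin.snoc (Pi.single a 1 : Fin d → ℤ) 0 : Fin (d + 1) → ℤ) k =
      if k = a.castSucc then 1 else 0 := by
    refine Fin.lastCases ?_ (fun b => ?_) k
    · simp [(Fin.castSucc_lt_last a).ne']
    · simp [Pi.single_apply]
  rw [latticeBary, h1, h2]

theorem vertexStep_succ {d : ℕ} (n k : Fin d) :
    vertexStep n k.succ = vertexStep n k.castSucc + if n = k then 1 else 0 := by
  simp only [vertexStep, Fin.lt_def, Fin.val_succ, Fin.val_castSucc, Fin.ext_iff]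
  split_ifs <;> omega

theorem latticeVertex_succ {d : ℕ} (z : Fin d → ℤ) (q : Equiv.Perm (Fin d)) (k : Fin d) :
    latticeVertex z q k.succ = latticeVertex z q k.castSucc + Pi.single (q.symm k) 1 := by
  ext m
  simp only [latticeVertex, vertexStep_succ, Pi.add_apply, Pi.single_apply, Equiv.eq_symm_apply]
  push_cast
  split_ifs <;> ring

theorem latticeBary_vertex_succ {d : ℕ} (N : ℤ) (z : Fin d → ℤ) (q : Equiv.Perm (Fin d))
    (k : Fin d) (m : Fin (d + 1)) :
    latticeBary N (latticeVertex z q k.succ) m = latticeBary N (latticeVertex z q k.castSucc) m +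
      ((if m = (q.symm k).succ then 1 else 0) - (if m = (q.symm k).castSucc then 1 else 0)) := by
  rw [latticeVertex_succ, ← latticeBary_single, ← latticeBary_add, add_zero]

/-- A barycentric coordinate varies by at most one on a Freudenthal simplex. -/
theorem latticeBary_le_add_one {d : ℕ} (N : ℤ) (z : Fin d → ℤ) (q : Equiv.Perm (Fin d))
    (k k' m : Fin (d + 1)) :
    latticeBary N (latticeVertex z q k) m ≤ latticeBary N (latticeVertex z q k') m + 1 := by
  have h1 : m = 0 ∨ ∃ a, m = Fin.succ a := by
    refine Fin.cases (Or.inl rfl) (fun a => Or.inr ⟨a, rfl⟩) m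
  have h2 : m = Fin.last d ∨ ∃ b, m = Fin.castSucc b := by
    refine Fin.lastCases (Or.inl rfl) (fun a => Or.inr ⟨a, rfl⟩) m
  have hc : (∀ y : Fin d → ℤ, (Fin.cons N y : Fin (d + 1) → ℤ) m = N) ∨
      ∃ a, ∀ y : Fin d → ℤ, (Fin.cons N y : Fin (d + 1) → ℤ) m = y a := by
    rcases h1 with rfl | ⟨a, rfl⟩
    · exact Or.inl fun y => by simp
    · exact Or.inr ⟨a, fun y => by simp⟩
  have hs : (∀ y : Fin d → ℤ, (Fin.snoc y 0 : Fin (d + 1) → ℤ) m = 0) ∨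
      ∃ b, ∀ y : Fin d → ℤ, (Fin.snoc y 0 : Fin (d + 1) → ℤ) m = y b := by
    rcases h2 with rfl | ⟨b, rfl⟩
    · exact Or.inl fun y => by simp
    · exact Or.inr ⟨b, fun y => by simp⟩
  simp only [latticeBary]
  rcases hc with hc | ⟨a, hc⟩ <;> rcases hs with hs | ⟨b, hs⟩ <;>
    simp only [hc, hs, latticeVertex, vertexStep, Fin.lt_def]
  · omega
  all_goals split_ifs <;> omega

theorem affine_sum_smul {d : ℕ} {ι : Type*} (s : Finset ι) (A : Space d →ᵃ[ℝ] ℝ) (c : ι → ℝ)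
    (p : ι → Space d) (hc : ∑ i ∈ s, c i = 1) :
    A (∑ i ∈ s, c i • p i) = ∑ i ∈ s, c i * A (p i) := by
  rw [affine_eq_linear_add A, map_sum]
  conv_lhs => rw [← one_mul (A 0), ← hc, Finset.sum_mul]
  rw [← Finset.sum_add_distrib]
  refine Finset.sum_congr rfl fun i _ => ?_
  rw [affine_eq_linear_add A (p i), map_smul, smul_eq_mul]
  ring

theorem sum_latticeBary_div {d : ℕ} {N : ℤ} (hN : N ≠ 0) (y : Fin d → ℤ) :
    ∑ k, (latticeBary N y k : ℝ) / N = 1 := by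
  rw [← Finset.sum_div, ← Int.cast_sum, sum_latticeBary, div_self]
  exact_mod_cast hN

theorem bary_latticePoint {d : ℕ} {T : Simp d} (hT : AffineIndependent ℝ T) {N : ℤ} (hN : N ≠ 0)
    (y : Fin d → ℤ) (m : Fin (d + 1)) :
    bary T m (latticePoint T N y) = latticeBary N y m / N := by
  rw [latticePoint, affine_sum_smul _ _ _ _ (sum_latticeBary_div hN y)]
  simp_rw [bary_vertex hT]
  simp

theorem midpoint_latticePoint {d : ℕ} (T : Simp d) {N : ℤ} (hN : N ≠ 0) (y y' : Fin d → ℤ) :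
    midpoint ℝ (latticePoint T N y) (latticePoint T N y') = latticePoint T (2 * N) (y + y') := by
  have hN' : (N : ℝ) ≠ 0 := by exact_mod_cast hN
  rw [midpoint_eq_smul_add, latticePoint, latticePoint, latticePoint, ← Finset.sum_add_distrib,
    Finset.smul_sum]
  refine Finset.sum_congr rfl fun k _ => ?_
  rw [two_mul, latticeBary_add, ← add_smul, smul_smul]
  congr 1
  rw [invOf_eq_inv]
  push_cast
  field_simp
  ring

theorem latticePoint_edge {d : ℕ} (T : Simp d) (N : ℤ) (z : Fin d → ℤ) (q : Equiv.Perm (Fin d))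
    (k : Fin d) :
    latticePoint T N (latticeVertex z q k.succ) - latticePoint T N (latticeVertex z q k.castSucc) =
      (1 / N : ℝ) • (T (q.symm k).succ - T (q.symm k).castSucc) := by
  rw [latticePoint, latticePoint, ← Finset.sum_sub_distrib]
  have : ∀ m, ((latticeBary N (latticeVertex z q k.succ) m : ℝ) / N) • T m -
      ((latticeBary N (latticeVertex z q k.castSucc) m : ℝ) / N) • T m =
      (1 / N : ℝ) • ((if m = (q.symm k).succ then T m else 0) -
        (if m = (q.symm k).castSucc then T m else 0)) := by
    intro m
    rw [latticeBary_vertex_succ, ← sub_smul]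
    push_cast
    split_ifs <;> module
  simp_rw [this]
  rw [← Finset.smul_sum, Finset.sum_sub_distrib]
  simp

/-! ### Children and parents of lattice simplices -/

theorem latticeBary_vertex_one {d : ℕ} (hd : d = 2 ∨ d = 3) (k m : Fin (d + 1)) :
    latticeBary 1 (latticeVertex (0 : Fin d → ℤ) 1 k) m = if m = k then 1 else 0 := by
  revert k m
  rcases hd with rfl | rfl <;> decide

theorem isLatticeSimplex_one {d : ℕ} (hd : d = 2 ∨ d = 3) (T : Simp d) :
    IsLatticeSimplex T 1 T := by
  have key := latticeBary_vertex_one hd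
  refine ⟨0, 1, fun k => ⟨fun m => ?_, ?_⟩⟩
  · rw [key]
    split_ifs <;> simp
  · rw [latticePoint]
    simp_rw [key]
    simp

theorem mem_Icc_of_latticeBary_nonneg {d : ℕ} (hd : d = 2 ∨ d = 3) {N : ℤ} {y : Fin d → ℤ}
    (h : ∀ m, 0 ≤ latticeBary N y m) (m : Fin d) : 0 ≤ y m ∧ y m ≤ N := by
  rcases hd with rfl | rfl
  · have h0 : 0 ≤ N - y 0 := h 0
    have h1 : 0 ≤ y 0 - y 1 := h 1
    have h2 : 0 ≤ y 1 - 0 := h 2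
    fin_cases m <;> simp <;> omega
  · have h0 : 0 ≤ N - y 0 := h 0
    have h1 : 0 ≤ y 0 - y 1 := h 1
    have h2 : 0 ≤ y 1 - y 2 := h 2
    have h3 : 0 ≤ y 2 - 0 := h 3
    fin_cases m <;> simp <;> omega

set_option maxRecDepth 100000 in
/-- Without subdivision the only Freudenthal simplex is `T` itself, with the original numbering. -/
theorem IsLatticeSimplex.eq_of_one {d : ℕ} (hd : d = 2 ∨ d = 3) {T t : Simp d}
    (h : IsLatticeSimplex T 1 t) : t = T := by
  obtain ⟨z, q, hq⟩ := h
  have hz : z = 0 := by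
    ext m
    have h0 := (mem_Icc_of_latticeBary_nonneg hd (hq 0).1 m).1
    have h1 := (mem_Icc_of_latticeBary_nonneg hd (hq (Fin.last d)).1 m).2
    simp only [latticeVertex, vertexStep, Fin.not_lt_zero, Fin.castSucc_lt_last, if_true,
      if_false] at h0 h1
    simp only [Pi.zero_apply]
    omega
  subst hz
  have hq1 : q = 1 := by
    have h0 : ∀ k m, 0 ≤ latticeBary 1 (latticeVertex (0 : Fin d → ℤ) q k) m := fun k => (hq k).1
    clear hq
    revert q
    rcases hd with rfl | rfl <;> decide
  subst hq1
  ext1 k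
  rw [(hq k).2, latticePoint]
  simp_rw [latticeBary_vertex_one hd]
  simp

theorem mem_children {d : ℕ} {t t' : Simp d} :
    t' ∈ children t ↔
      ∃ s ∈ childTable d, ∀ k, t' k = midpoint ℝ (t (s k).1) (t (s k).2) := by
  simp only [children, List.mem_map]
  refine exists_congr fun s => and_congr_right fun _ => ?_
  exact ⟨fun h k => by rw [← h], fun h => (funext h).symm⟩

theorem IsLatticeSimplex.child {d : ℕ} (hd : d = 2 ∨ d = 3) {T t t' : Simp d} {N : ℤ} (hN : N ≠ 0)
    (h : IsLatticeSimplex T N t) (ht' : t' ∈ children t) : IsLatticeSimplex T (2 * N) t' := by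
  obtain ⟨z, q, hq⟩ := h
  obtain ⟨s, hs, hst⟩ := mem_children.1 ht'
  obtain ⟨r, hr⟩ := childTable_eq_permuted hd s hs
  let z' : Fin d → ℤ := fun m =>
    2 * z m + (vertexStep (q m) (s 0).1 + vertexStep (q m) (s 0).2 : ℕ)
  have hadd : ∀ k, latticeVertex z' (q.trans r) k =
      latticeVertex z q (s k).1 + latticeVertex z q (s k).2 := by
    intro k
    ext m
    have := hr (q m) k
    simp only [latticeVertex, z', Pi.add_apply, Equiv.trans_apply]
    omega
  refine ⟨z', q.trans r, fun k => ⟨fun m => ?_, ?_⟩⟩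
  · rw [hadd, two_mul, latticeBary_add]
    exact add_nonneg ((hq _).1 m) ((hq _).1 m)
  · rw [hst, (hq _).2, (hq _).2, midpoint_latticePoint T hN, hadd]

/-- The walls of the subdivided simplex are lattice planes, so that the parent of a Freudenthal
simplex does not cross them. -/
theorem IsLatticeSimplex.exists_parent {d : ℕ} (hd : d = 2 ∨ d = 3) {T t' : Simp d} {N : ℤ}
    (hN : N ≠ 0) (h : IsLatticeSimplex T (2 * N) t') :
    ∃ t, IsLatticeSimplex T N t ∧ t' ∈ children t := by
  obtain ⟨z', q', hq'⟩ := h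
  obtain ⟨s, hs, q, hq⟩ := exists_mem_childTable hd
    (fun n => ⟨(z' (q'.symm n) % 2).toNat, by omega⟩)
  let z : Fin d → ℤ := fun m => z' m / 2
  have hadd : ∀ k, latticeVertex z' q' k =
      latticeVertex z (q'.trans q) (s k).1 + latticeVertex z (q'.trans q) (s k).2 := by
    intro k
    ext m
    have := hq (q' m) k
    simp only [Equiv.symm_apply_apply] at this
    simp only [latticeVertex, z, Pi.add_apply, Equiv.trans_apply]
    omega
  have hpos : ∀ k m, 0 ≤ latticeBary N (latticeVertex z (q'.trans q) k) m := by
    intro k m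
    by_contra! hneg
    have hle : ∀ k', latticeBary N (latticeVertex z (q'.trans q) k') m ≤ 0 := fun k' => by
      have := latticeBary_le_add_one N z (q'.trans q) k' k m
      omega
    have hzero : ∀ k', latticeBary (2 * N) (latticeVertex z' q' k') m = 0 := by
      intro k'
      refine le_antisymm ?_ ((hq' k').1 m)
      rw [hadd, two_mul, latticeBary_add]
      have h1 := hle (s k').1
      have h2 := hle (s k').2
      omega
    -- a barycentric coordinate is not constant on a Freudenthal simplex
    obtain ⟨a, ha⟩ : ∃ a : Fin d, m = a.succ ∨ m = a.castSucc := by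
      refine Fin.cases ?_ (fun a => ⟨a, Or.inl rfl⟩) m
      exact ⟨⟨0, by omega⟩, Or.inr rfl⟩
    have hstep := latticeBary_vertex_succ (2 * N) z' q' (q' a) m
    rw [hzero, hzero, Equiv.symm_apply_apply] at hstep
    have hne : a.succ ≠ a.castSucc := (Fin.castSucc_lt_succ (i := a)).ne'
    rcases ha with rfl | rfl
    · simp [hne] at hstep
    · simp [hne.symm] at hstep
  refine ⟨fun k => latticePoint T N (latticeVertex z (q'.trans q) k),
    ⟨z, q'.trans q, fun k => ⟨hpos k, rfl⟩⟩, mem_children.2 ⟨s, hs, fun k => ?_⟩⟩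
  rw [(hq' k).2, midpoint_latticePoint T hN, hadd]

theorem mem_redRefine {d : ℕ} {𝒯 : Finset (Simp d)} {t' : Simp d} :
    t' ∈ redRefine 𝒯 ↔ ∃ t ∈ 𝒯, t' ∈ children t := by
  classical
  simp [redRefine]

theorem uniformMesh_succ {d : ℕ} (𝒯H : Finset (Simp d)) (ℓ : ℕ) :
    uniformMesh 𝒯H (ℓ + 1) = redRefine (uniformMesh 𝒯H ℓ) :=
  Function.iterate_succ_apply' _ _ _

/-- The uniformly refined mesh consists of all Freudenthal simplices of the `2^ℓ`-fold subdivision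
of the macro elements. -/
theorem mem_uniformMesh {d : ℕ} (hd : d = 2 ∨ d = 3) {𝒯H : Finset (Simp d)} {ℓ : ℕ}
    {t : Simp d} : t ∈ uniformMesh 𝒯H ℓ ↔ ∃ T ∈ 𝒯H, IsLatticeSimplex T (2 ^ ℓ) t := by
  induction ℓ generalizing t with
  | zero =>
    constructor
    · exact fun ht => ⟨t, ht, isLatticeSimplex_one hd t⟩
    · rintro ⟨T, hT, h⟩
      obtain rfl := h.eq_of_one hd
      exact hT
  | succ ℓ ih =>
    rw [uniformMesh_succ, mem_redRefine, pow_succ']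
    constructor
    · rintro ⟨p, hp, ht⟩
      obtain ⟨T, hT, h⟩ := ih.1 hp
      exact ⟨T, hT, h.child hd (by positivity) ht⟩
    · rintro ⟨T, hT, h⟩
      obtain ⟨p, hp, ht⟩ := h.exists_parent hd (by positivity)
      exact ⟨p, ih.2 ⟨T, hT, hp⟩, ht⟩

theorem vertexStep_rev {d : ℕ} (n : Fin d) (k : Fin (d + 1)) :
    vertexStep n (Fin.rev k) + vertexStep (Fin.rev n) k = 1 := by
  simp only [vertexStep, Fin.lt_def, Fin.val_rev, Fin.val_castSucc]
  split_ifs <;> omega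

/-- The Freudenthal triangulation is invariant under the reflection about an edge midpoint. -/
theorem IsLatticeSimplex.reflect {d : ℕ} {T t : Simp d} (hT : AffineIndependent ℝ T) {N : ℤ}
    (hN : 0 < N) (h : IsLatticeSimplex T N t) {i : Fin (d + 1)} (hi : t i ∈ interior (body T))
    (j : Fin (d + 1)) : IsLatticeSimplex T N (reflect t i j) := by
  obtain ⟨z, q, hq⟩ := h
  let z' : Fin d → ℤ := fun m => z m + vertexStep (q m) i + vertexStep (q m) j - 1
  have hadd : ∀ k, latticeVertex z' (q.trans Fin.revPerm) k + latticeVertex z q (Fin.rev k) =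
      latticeVertex z q i + latticeVertex z q j := by
    intro k
    ext m
    have := vertexStep_rev (q m) k
    simp only [latticeVertex, z', Pi.add_apply, Equiv.trans_apply, Fin.revPerm_apply]
    omega
  have hb : ∀ k m, latticeBary N (latticeVertex z' (q.trans Fin.revPerm) k) m +
      latticeBary N (latticeVertex z q (Fin.rev k)) m =
      latticeBary N (latticeVertex z q i) m + latticeBary N (latticeVertex z q j) m := by
    intro k m
    rw [← latticeBary_add, ← latticeBary_add, hadd]
  refine ⟨z', q.trans Fin.revPerm, fun k => ⟨fun m => ?_, ?_⟩⟩
  · have h1 : 0 < latticeBary N (latticeVertex z q i) m := by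
      have := (mem_interior_body_iff hT).1 hi m
      rw [(hq i).2, bary_latticePoint hT hN.ne'] at this
      have hN' : (0 : ℝ) < N := by exact_mod_cast hN
      exact_mod_cast (div_pos_iff_of_pos_right hN').1 this
    have h2 := latticeBary_le_add_one N z q (Fin.rev k) j m
    have h3 := hb k m
    omega
  · rw [StencilScaling.reflect, (hq i).2, (hq j).2, (hq (Fin.rev k)).2, sub_eq_iff_eq_add]
    simp only [latticePoint, ← Finset.sum_add_distrib, ← add_smul, ← add_div]
    refine Finset.sum_congr rfl fun m _ => ?_
    have := hb k m
    rw [← Int.cast_add, ← Int.cast_add, this]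

/-! ### Metric properties of lattice simplices -/

/-- The edges between consecutive vertices of a nondegenerate simplex span the space. -/
theorem linearMap_eq_zero_of_edges {d : ℕ} {T : Simp d} (hT : AffineIndependent ℝ T)
    {F : Type*} [AddCommGroup F] [Module ℝ F] (f : Space d →ₗ[ℝ] F)
    (h : ∀ m : Fin d, f (T m.succ - T m.castSucc) = 0) : f = 0 := by
  have h0 : ∀ k, f (T k) = f (T 0) := by
    intro k
    induction k using Fin.induction with
    | zero => rfl
    | succ m ih =>
      have := h m
      rw [map_sub, sub_eq_zero] at this
      rw [this, ih]
  have h1 : ∀ x, f x = f (T 0) := by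
    intro x
    conv_lhs => rw [← sum_bary_smul hT x, map_sum]
    simp_rw [map_smul, h0, ← Finset.sum_smul, sum_bary hT, one_smul]
  ext1 x
  rw [h1 x, ← h1 0, map_zero, LinearMap.zero_apply]

theorem IsLatticeSimplex.exists_edge_perm {d : ℕ} {T t : Simp d} {N : ℤ}
    (h : IsLatticeSimplex T N t) : ∃ q : Equiv.Perm (Fin d), ∀ k : Fin d,
      t k.succ - t k.castSucc = (1 / N : ℝ) • (T (q k).succ - T (q k).castSucc) := by
  obtain ⟨z, q, hq⟩ := h
  refine ⟨q.symm, fun k => ?_⟩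
  rw [(hq _).2, (hq _).2, latticePoint_edge]

/-- The affine map that sends the vertices of `T` to those of `t`. -/
noncomputable def simplexMap {d : ℕ} (T t : Simp d) : Space d →ᵃ[ℝ] Space d :=
  ∑ k, (LinearMap.toSpanSingleton ℝ (Space d) (t k)).toAffineMap.comp (bary T k)

theorem simplexMap_apply {d : ℕ} (T t : Simp d) (x : Space d) :
    simplexMap T t x = ∑ k, bary T k x • t k := by
  rw [simplexMap]
  induction (Finset.univ : Finset (Fin (d + 1))) using Finset.cons_induction with
  | empty => simp
  | cons a s ha ih => rw [Finset.sum_cons, Finset.sum_cons, ← ih]; simp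

theorem simplexMap_vertex {d : ℕ} {T : Simp d} (hT : AffineIndependent ℝ T) (t : Simp d)
    (k : Fin (d + 1)) : simplexMap T t (T k) = t k := by
  simp_rw [simplexMap_apply, bary_vertex hT]
  simp

theorem simplexMap_image {d : ℕ} {T : Simp d} (hT : AffineIndependent ℝ T) (t : Simp d) :
    simplexMap T t '' body T = body t := by
  rw [body, AffineMap.image_convexHull, body, ← Set.range_comp]
  congr 2
  ext1 k
  exact simplexMap_vertex hT t k

/-- The linear map permutes the edges between consecutive vertices of `T` and scales them by `1/N`,
so that its determinant has the absolute value `N^{-d}`. -/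
theorem IsLatticeSimplex.abs_det {d : ℕ} {T t : Simp d} (hT : AffineIndependent ℝ T) {N : ℤ}
    (hN : 0 < N) (h : IsLatticeSimplex T N t) :
    |LinearMap.det (simplexMap T t).linear| = (1 / N : ℝ) ^ d := by
  obtain ⟨q, hq⟩ := h.exists_edge_perm
  set L := (simplexMap T t).linear with hL
  have hN' : (0 : ℝ) < N := by exact_mod_cast hN
  have hedge : ∀ m : Fin d, L (T m.succ - T m.castSucc) =
      (1 / N : ℝ) • (T (q m).succ - T (q m).castSucc) := by
    intro m
    rw [← hq, ← simplexMap_vertex hT t, ← simplexMap_vertex hT t]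
    exact (simplexMap T t).linearMap_vsub _ _
  have hpow : ∀ n : ℕ, ∀ m : Fin d, (L ^ n) (T m.succ - T m.castSucc) =
      (1 / N : ℝ) ^ n • (T ((q ^ n) m).succ - T ((q ^ n) m).castSucc) := by
    intro n
    induction n with
    | zero => simp
    | succ n ih =>
      intro m
      rw [pow_succ', Module.End.mul_apply, ih, map_smul, hedge, smul_smul, ← pow_succ, pow_succ' q]
      rfl
  -- a power of the permutation of the edges is trivial, so that a power of `L` is a homothety
  have hn := orderOf_pos q
  have hfin : L ^ orderOf q = (1 / N : ℝ) ^ orderOf q • LinearMap.id := by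
    rw [← sub_eq_zero]
    refine linearMap_eq_zero_of_edges hT _ fun m => ?_
    rw [LinearMap.sub_apply, hpow, pow_orderOf_eq_one]
    simp
  have hdet := congrArg (fun f => |LinearMap.det f|) hfin
  simp only [map_pow, LinearMap.det_smul, LinearMap.det_id, mul_one, abs_pow,
    finrank_euclideanSpace, Fintype.card_fin] at hdet
  rw [abs_of_pos (by positivity : (0 : ℝ) < 1 / N), ← pow_mul, mul_comm, pow_mul] at hdet
  exact (pow_left_inj₀ (abs_nonneg _) (by positivity) hn.ne').1 hdet

theorem IsLatticeSimplex.affineIndependent {d : ℕ} {T t : Simp d} (hT : AffineIndependent ℝ T)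
    {N : ℤ} (hN : 0 < N) (h : IsLatticeSimplex T N t) : AffineIndependent ℝ t := by
  have hN' : (0 : ℝ) < N := by exact_mod_cast hN
  have hdet : LinearMap.det (simplexMap T t).linear ≠ 0 := by
    rw [← abs_pos, h.abs_det hT hN]
    positivity
  have hinj : Function.Injective (simplexMap T t) := by
    rw [← AffineMap.linear_injective_iff]
    exact (LinearMap.equivOfDetNeZero _ hdet).injective
  have : t = simplexMap T t ∘ T := by
    ext1 k
    exact (simplexMap_vertex hT t k).symm
  rw [this]
  exact hT.map' _ hinj

theorem IsLatticeSimplex.volume_body {d : ℕ} {T t : Simp d} (hT : AffineIndependent ℝ T) {N : ℤ}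
    (hN : 0 < N) (h : IsLatticeSimplex T N t) :
    volume.real (body t) = (1 / N : ℝ) ^ d * volume.real (body T) := by
  have e : (simplexMap T t : Space d → Space d) =
      (fun x => x + simplexMap T t 0) ∘ (simplexMap T t).linear := by
    ext1 x
    have h := (simplexMap T t).linearMap_vsub x 0
    simp only [vsub_eq_sub, sub_zero] at h
    rw [Function.comp_apply, h, sub_add_cancel]
  rw [← simplexMap_image hT t, e, Set.image_comp, measureReal_def, Set.image_add_right,
    measure_preimage_add_right, Measure.addHaar_image_linearMap, h.abs_det hT hN,
    ENNReal.toReal_mul, ENNReal.toReal_ofReal, measureReal_def]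
  have hN' : (0 : ℝ) < N := by exact_mod_cast hN
  positivity

theorem IsLatticeSimplex.body_subset {d : ℕ} {T t : Simp d} {N : ℤ}
    (hN : 0 < N) (h : IsLatticeSimplex T N t) : body t ⊆ body T := by
  obtain ⟨z, q, hq⟩ := h
  refine convexHull_min ?_ (convex_body T)
  rintro _ ⟨k, rfl⟩
  have hN' : (0 : ℝ) < N := by exact_mod_cast hN
  rw [(hq k).2, latticePoint]
  refine (convex_body T).sum_mem (fun m _ => ?_) (sum_latticeBary_div hN.ne' _)
    fun m _ => vertex_mem_body T m
  have := (hq k).1 m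
  positivity

theorem IsLatticeSimplex.diam_le {d : ℕ} {T t : Simp d} {N : ℤ}
    (hN : 0 < N) (h : IsLatticeSimplex T N t) :
    Metric.diam (body t) ≤ 2 * d * (Metric.diam (body T) / N) := by
  obtain ⟨q, hq⟩ := h.exists_edge_perm
  have hN' : (0 : ℝ) < N := by exact_mod_cast hN
  have hD : 0 ≤ Metric.diam (body T) := Metric.diam_nonneg
  have hk : ∀ k : Fin (d + 1), ‖t k - t 0‖ ≤ (k : ℕ) * (Metric.diam (body T) / N) := by
    intro k
    induction k using Fin.induction with
    | zero => simp
    | succ m ih =>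
      have e : t m.succ - t 0 = (t m.succ - t m.castSucc) + (t m.castSucc - t 0) := by abel
      have h1 : ‖t m.succ - t m.castSucc‖ ≤ Metric.diam (body T) / N := by
        rw [hq, norm_smul, Real.norm_of_nonneg (by positivity), div_mul_eq_mul_div, one_mul]
        gcongr
        exact norm_sub_le_diam_body T (vertex_mem_body T _) (vertex_mem_body T _)
      rw [e]
      refine (norm_add_le _ _).trans ((add_le_add h1 ih).trans (le_of_eq ?_))
      simp
      ring
  have hkd : ∀ k : Fin (d + 1), ‖t k - t 0‖ ≤ d * (Metric.diam (body T) / N) := by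
    intro k
    refine (hk k).trans ?_
    gcongr
    exact_mod_cast Nat.lt_succ_iff.1 k.2
  rw [body, convexHull_diam]
  refine Metric.diam_le_of_forall_dist_le (by positivity) ?_
  rintro _ ⟨i, rfl⟩ _ ⟨j, rfl⟩
  rw [dist_eq_norm]
  have e : t i - t j = (t i - t 0) - (t j - t 0) := by abel
  rw [e]
  refine (norm_sub_le _ _).trans ((add_le_add (hkd i) (hkd j)).trans (le_of_eq ?_))
  ring

/-- The products of the diameter and the lengths of the gradients of the barycentric coordinates are
bounded independently of the level of refinement. -/
theorem exists_shape_bound {d : ℕ} {T : Simp d} (hT : AffineIndependent ℝ T) :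
    ∃ ρ : ℝ, 0 ≤ ρ ∧ ∀ (N : ℤ) (t : Simp d), 0 < N → IsLatticeSimplex T N t → ∀ i,
      Metric.diam (body t) * ‖affGrad (bary t i)‖ ≤ ρ := by
  let ev : Space d →ₗ[ℝ] (Fin d → ℝ) :=
    LinearMap.pi fun m => (innerₗ (Space d)) (T m.succ - T m.castSucc)
  have hev : ∀ g m, ev g m = ⟪T m.succ - T m.castSucc, g⟫ := fun g m => rfl
  have hker : ev.ker = ⊥ := by
    rw [LinearMap.ker_eq_bot']
    intro g hg
    have h0 : innerₗ (Space d) g = 0 := by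
      refine linearMap_eq_zero_of_edges hT _ fun m => ?_
      have := congrFun hg m
      rw [hev] at this
      rw [innerₗ_apply_apply, real_inner_comm]
      exact this
    have := congrArg (fun f => f g) h0
    simpa using this
  obtain ⟨K, -, hK⟩ := ev.exists_antilipschitzWith hker
  refine ⟨2 * d * Metric.diam (body T) * K, by positivity, fun N t hN h i => ?_⟩
  have hN' : (0 : ℝ) < N := by exact_mod_cast hN
  obtain ⟨q, hq⟩ := h.exists_edge_perm
  have ht := h.affineIndependent hT hN
  have hg : ‖affGrad (bary t i)‖ ≤ K * N := by
    have h1 := hK.le_mul_dist (affGrad (bary t i)) 0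
    rw [map_zero, dist_zero_right, dist_zero_right] at h1
    refine h1.trans ?_
    gcongr
    refine (pi_norm_le_iff_of_nonneg hN'.le).2 fun m => ?_
    have h2 : T m.succ - T m.castSucc =
        (N : ℝ) • (t (q.symm m).succ - t (q.symm m).castSucc) := by
      rw [hq, Equiv.apply_symm_apply, smul_smul, mul_one_div_cancel hN'.ne', one_smul]
    rw [hev, h2, real_inner_comm, real_inner_smul_right, inner_affGrad_sub, bary_vertex ht,
      bary_vertex ht, norm_mul, Real.norm_of_nonneg hN'.le]
    refine mul_le_of_le_one_right hN'.le ?_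
    split_ifs <;> norm_num
  calc _ ≤ (2 * d * (Metric.diam (body T) / N)) * (K * N) := by
        gcongr
        exact h.diam_le hN
    _ = _ := by field_simp

/-! ### Uniform refinement yields a subdivision -/

theorem mem_body_child {d : ℕ} {t : Simp d} {s : Fin (d + 1) → Fin (d + 1) × Fin (d + 1)}
    (hs : s ∈ childTable d) (μ : Fin (d + 1) → ℝ) (h0 : ∀ k, 0 ≤ μ k) (h1 : ∑ k, μ k = 1) :
    ∃ t' ∈ children t, ∑ k, μ k • midpoint ℝ (t (s k).1) (t (s k).2) ∈ body t' := by
  refine ⟨fun k => midpoint ℝ (t (s k).1) (t (s k).2), mem_children.2 ⟨s, hs, fun k => rfl⟩, ?_⟩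
  exact (convex_convexHull ℝ _).sum_mem (fun k _ => h0 k) h1
    fun k _ => subset_convexHull ℝ _ (Set.mem_range_self k)

/-- The children cover the parent: near the vertex `x_i`, where the `i`-th barycentric coordinate is
at least `1/2`, lies the `i`-th child. What is left is the inner triangle if `d = 2`, and if `d = 3`
an octahedron, which is cut into four pieces by two planes. -/
theorem exists_mem_body_child {d : ℕ} (hd : d = 2 ∨ d = 3) {t : Simp d}
    (ht : AffineIndependent ℝ t) {x : Space d} (hx : x ∈ body t) :
    ∃ t' ∈ children t, x ∈ body t' := by
  have h0 := (mem_body_iff ht).1 hx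
  have h1 := sum_bary ht x
  have hx' := sum_bary_smul ht x
  generalize hl : (fun i => bary t i x) = l at *
  have hl' : ∀ i, bary t i x = l i := fun i => congrFun hl i
  simp only [hl'] at h0 h1 hx'
  clear hl hl' hx
  -- it suffices to give barycentric coordinates with respect to one of the children
  suffices hs : ∃ s ∈ childTable d, ∃ μ : Fin (d + 1) → ℝ, (∀ k, 0 ≤ μ k) ∧ ∑ k, μ k = 1 ∧
      ∑ k, μ k • midpoint ℝ (t (s k).1) (t (s k).2) = x by
    obtain ⟨s, hs, μ, a, b, c⟩ := hs
    rw [← c]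
    exact mem_body_child hs μ a b
  subst hx'
  rcases hd with rfl | rfl
  · have p0 := h0 0
    have p1 := h0 1
    have p2 := h0 2
    replace h1 : l 0 + l 1 + l 2 = 1 := (Fin.sum_univ_three l).symm.trans h1
    by_cases c0 : l 1 + l 2 ≤ l 0
    · refine ⟨![(0, 0), (0, 1), (0, 2)], by simp [childTable],
        ![l 0 - l 1 - l 2, 2 * l 1, 2 * l 2], ?_, ?_, ?_⟩
      · intro k; fin_cases k <;> simp <;> linarith
      · refine (Fin.sum_univ_three _).trans ?_
        simp; linarith
      · refine (Fin.sum_univ_three _).trans (Eq.trans ?_ (Fin.sum_univ_three _).symm)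
        simp [midpoint_eq_smul_add]; module
    by_cases c1 : l 0 + l 2 ≤ l 1
    · refine ⟨![(0, 1), (1, 1), (1, 2)], by simp [childTable],
        ![2 * l 0, l 1 - l 0 - l 2, 2 * l 2], ?_, ?_, ?_⟩
      · intro k; fin_cases k <;> simp <;> linarith
      · refine (Fin.sum_univ_three _).trans ?_
        simp; linarith
      · refine (Fin.sum_univ_three _).trans (Eq.trans ?_ (Fin.sum_univ_three _).symm)
        simp [midpoint_eq_smul_add]; module
    by_cases c2 : l 0 + l 1 ≤ l 2
    · refine ⟨![(0, 2), (1, 2), (2, 2)], by simp [childTable],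
        ![2 * l 0, 2 * l 1, l 2 - l 0 - l 1], ?_, ?_, ?_⟩
      · intro k; fin_cases k <;> simp <;> linarith
      · refine (Fin.sum_univ_three _).trans ?_
        simp; linarith
      · refine (Fin.sum_univ_three _).trans (Eq.trans ?_ (Fin.sum_univ_three _).symm)
        simp [midpoint_eq_smul_add]; module
    · refine ⟨![(0, 1), (0, 2), (1, 2)], by simp [childTable],
        ![l 0 + l 1 - l 2, l 0 + l 2 - l 1, l 1 + l 2 - l 0], ?_, ?_, ?_⟩
      · intro k; fin_cases k <;> simp <;> linarith
      · refine (Fin.sum_univ_three _).trans ?_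
        simp; linarith
      · refine (Fin.sum_univ_three _).trans (Eq.trans ?_ (Fin.sum_univ_three _).symm)
        simp [midpoint_eq_smul_add]; module
  · have p0 := h0 0
    have p1 := h0 1
    have p2 := h0 2
    have p3 := h0 3
    replace h1 : l 0 + l 1 + l 2 + l 3 = 1 := (Fin.sum_univ_four l).symm.trans h1
    by_cases c0 : l 1 + l 2 + l 3 ≤ l 0
    · refine ⟨![(0, 0), (0, 1), (0, 2), (0, 3)], by simp [childTable],
        ![l 0 - l 1 - l 2 - l 3, 2 * l 1, 2 * l 2, 2 * l 3], ?_, ?_, ?_⟩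
      · intro k; fin_cases k <;> simp <;> linarith
      · refine (Fin.sum_univ_four _).trans ?_
        simp; linarith
      · refine (Fin.sum_univ_four _).trans (Eq.trans ?_ (Fin.sum_univ_four _).symm)
        simp [midpoint_eq_smul_add]; module
    by_cases c1 : l 0 + l 2 + l 3 ≤ l 1
    · refine ⟨![(0, 1), (1, 1), (1, 2), (1, 3)], by simp [childTable],
        ![2 * l 0, l 1 - l 0 - l 2 - l 3, 2 * l 2, 2 * l 3], ?_, ?_, ?_⟩
      · intro k; fin_cases k <;> simp <;> linarith
      · refine (Fin.sum_univ_four _).trans ?_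
        simp; linarith
      · refine (Fin.sum_univ_four _).trans (Eq.trans ?_ (Fin.sum_univ_four _).symm)
        simp [midpoint_eq_smul_add]; module
    by_cases c2 : l 0 + l 1 + l 3 ≤ l 2
    · refine ⟨![(0, 2), (1, 2), (2, 2), (2, 3)], by simp [childTable],
        ![2 * l 0, 2 * l 1, l 2 - l 0 - l 1 - l 3, 2 * l 3], ?_, ?_, ?_⟩
      · intro k; fin_cases k <;> simp <;> linarith
      · refine (Fin.sum_univ_four _).trans ?_
        simp; linarith
      · refine (Fin.sum_univ_four _).trans (Eq.trans ?_ (Fin.sum_univ_four _).symm)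
        simp [midpoint_eq_smul_add]; module
    by_cases c3 : l 0 + l 1 + l 2 ≤ l 3
    · refine ⟨![(0, 3), (1, 3), (2, 3), (3, 3)], by simp [childTable],
        ![2 * l 0, 2 * l 1, 2 * l 2, l 3 - l 0 - l 1 - l 2], ?_, ?_, ?_⟩
      · intro k; fin_cases k <;> simp <;> linarith
      · refine (Fin.sum_univ_four _).trans ?_
        simp; linarith
      · refine (Fin.sum_univ_four _).trans (Eq.trans ?_ (Fin.sum_univ_four _).symm)
        simp [midpoint_eq_smul_add]; module
    by_cases cA : l 2 + l 3 ≤ l 0 + l 1 <;> by_cases cB : l 1 + l 2 ≤ l 0 + l 3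
    · refine ⟨![(0, 1), (0, 2), (0, 3), (1, 3)], by simp [childTable],
        ![l 0 + l 1 - l 2 - l 3, 2 * l 2, l 0 + l 3 - l 1 - l 2, l 1 + l 2 + l 3 - l 0],
        ?_, ?_, ?_⟩
      · intro k; fin_cases k <;> simp <;> linarith
      · refine (Fin.sum_univ_four _).trans ?_
        simp; linarith
      · refine (Fin.sum_univ_four _).trans (Eq.trans ?_ (Fin.sum_univ_four _).symm)
        simp [midpoint_eq_smul_add]; module
    · refine ⟨![(0, 1), (0, 2), (1, 2), (1, 3)], by simp [childTable],
        ![l 0 + l 1 - l 2 - l 3, l 0 + l 2 + l 3 - l 1, l 1 + l 2 - l 0 - l 3, 2 * l 3],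
        ?_, ?_, ?_⟩
      · intro k; fin_cases k <;> simp <;> linarith
      · refine (Fin.sum_univ_four _).trans ?_
        simp; linarith
      · refine (Fin.sum_univ_four _).trans (Eq.trans ?_ (Fin.sum_univ_four _).symm)
        simp [midpoint_eq_smul_add]; module
    · refine ⟨![(0, 2), (0, 3), (1, 3), (2, 3)], by simp [childTable],
        ![l 0 + l 1 + l 2 - l 3, l 0 + l 3 - l 1 - l 2, 2 * l 1, l 2 + l 3 - l 0 - l 1],
        ?_, ?_, ?_⟩
      · intro k; fin_cases k <;> simp <;> linarith
      · refine (Fin.sum_univ_four _).trans ?_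
        simp; linarith
      · refine (Fin.sum_univ_four _).trans (Eq.trans ?_ (Fin.sum_univ_four _).symm)
        simp [midpoint_eq_smul_add]; module
    · refine ⟨![(0, 2), (1, 2), (1, 3), (2, 3)], by simp [childTable],
        ![2 * l 0, l 1 + l 2 - l 0 - l 3, l 0 + l 1 + l 3 - l 2, l 2 + l 3 - l 0 - l 1],
        ?_, ?_, ?_⟩
      · intro k; fin_cases k <;> simp <;> linarith
      · refine (Fin.sum_univ_four _).trans ?_
        simp; linarith
      · refine (Fin.sum_univ_four _).trans (Eq.trans ?_ (Fin.sum_univ_four _).symm)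
        simp [midpoint_eq_smul_add]; module

theorem isLatticeSimplex_of_mem_children {d : ℕ} (hd : d = 2 ∨ d = 3) {t t' : Simp d}
    (h : t' ∈ children t) : IsLatticeSimplex t 2 t' :=
  (isLatticeSimplex_one hd t).child hd one_ne_zero h

theorem length_children {d : ℕ} (hd : d = 2 ∨ d = 3) (t : Simp d) :
    (children t).length = 2 ^ d := by
  rw [children, List.length_map]
  rcases hd with rfl | rfl <;> rfl

/-- The `2^d` children cover the parent and each has the volume `2^{-d} |t|`, which leaves no room
for overlaps. -/
theorem volume_inter_children {d : ℕ} (hd : d = 2 ∨ d = 3) {t : Simp d}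
    (ht : AffineIndependent ℝ t) {a b : Simp d} (ha : a ∈ children t) (hb : b ∈ children t)
    (hne : a ≠ b) : volume (body a ∩ body b) = 0 := by
  classical
  set V := volume.real (body t) with hV
  set c : ℝ := (1 / 2 : ℝ) ^ d * V with hc
  have hc0 : 0 ≤ c := mul_nonneg (by positivity) measureReal_nonneg
  have hvol : ∀ t' ∈ children t, volume.real (body t') = c := fun t' ht' => by
    have := (isLatticeSimplex_of_mem_children hd ht').volume_body ht two_pos
    rw [this, hc, hV]
    norm_num
  set R := ((children t).toFinset.erase a).erase b with hR
  have hcard : R.card + 2 ≤ 2 ^ d := by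
    have h1 : (children t).toFinset.card ≤ 2 ^ d :=
      (List.toFinset_card_le _).trans (length_children hd t).le
    have h2 : a ∈ (children t).toFinset := List.mem_toFinset.2 ha
    have h3 : b ∈ (children t).toFinset.erase a :=
      Finset.mem_erase.2 ⟨hne.symm, List.mem_toFinset.2 hb⟩
    have h4 := Finset.card_erase_add_one h2
    have h5 := Finset.card_erase_add_one h3
    rw [← hR] at h5
    omega
  have hcover : body t ⊆ (body a ∪ body b) ∪ ⋃ t' ∈ R, body t' := by
    intro x hx
    obtain ⟨t', ht', hxt'⟩ := exists_mem_body_child hd ht hx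
    by_cases h1 : t' = a
    · exact Or.inl (Or.inl (h1 ▸ hxt'))
    by_cases h2 : t' = b
    · exact Or.inl (Or.inr (h2 ▸ hxt'))
    · exact Or.inr (Set.mem_biUnion (Finset.mem_erase.2 ⟨h2, Finset.mem_erase.2
        ⟨h1, List.mem_toFinset.2 ht'⟩⟩) hxt')
  have hfin : ∀ s : Simp d, volume (body s) ≠ ⊤ := fun s => (volume_body_lt_top s).ne
  have hfinR : volume (⋃ t' ∈ R, body t') ≠ ⊤ :=
    (measure_biUnion_lt_top R.finite_toSet fun s _ => volume_body_lt_top s).ne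
  have hfinab : volume (body a ∪ body b) ≠ ⊤ :=
    (measure_union_lt_top (volume_body_lt_top a) (volume_body_lt_top b)).ne
  have h1 : V ≤ volume.real (body a ∪ body b) + volume.real (⋃ t' ∈ R, body t') :=
    (measureReal_mono hcover (measure_union_ne_top hfinab hfinR)).trans
      (measureReal_union_le _ _)
  have h2 : volume.real (⋃ t' ∈ R, body t') ≤ R.card * c := by
    refine (measureReal_biUnion_finset_le R body).trans (le_of_eq ?_)
    rw [Finset.sum_congr rfl fun t' ht' => hvol t' ?_]
    · simp
    · exact List.mem_toFinset.1 (Finset.mem_of_mem_erase (Finset.mem_of_mem_erase ht'))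
  have h3 := measureReal_union_add_inter (μ := volume) (s := body a)
    (measurableSet_body b) (hfin a) (hfin b)
  rw [hvol a ha, hvol b hb] at h3
  have h4 : V = 2 ^ d * c := by
    rw [hc, ← mul_assoc, ← mul_pow]
    norm_num
  have h5 : ((R.card : ℝ) + 2) * c ≤ 2 ^ d * c := by
    gcongr
    exact_mod_cast hcard
  have h6 : volume.real (body a ∩ body b) = 0 :=
    le_antisymm (by linarith) measureReal_nonneg
  rwa [measureReal_eq_zero_iff (measure_ne_top_of_subset Set.inter_subset_left (hfin a))] at h6

theorem body_child_subset {d : ℕ} (hd : d = 2 ∨ d = 3) {t t' : Simp d} (h : t' ∈ children t) :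
    body t' ⊆ body t :=
  (isLatticeSimplex_of_mem_children hd h).body_subset two_pos

theorem IsTiling.redRefine {d : ℕ} (hd : d = 2 ∨ d = 3) {𝒯 : Finset (Simp d)} (h : IsTiling 𝒯) :
    IsTiling (redRefine 𝒯) := by
  refine ⟨fun t' ht' => ?_, fun a ha b hb hne => ?_⟩
  · obtain ⟨t, ht, hc⟩ := mem_redRefine.1 ht'
    exact (isLatticeSimplex_of_mem_children hd hc).affineIndependent (h.nondegenerate t ht) two_pos
  · obtain ⟨s, hs, has⟩ := mem_redRefine.1 ha
    obtain ⟨t, ht, hbt⟩ := mem_redRefine.1 hb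
    by_cases hst : s = t
    · subst hst
      exact volume_inter_children hd (h.nondegenerate s hs) has hbt hne
    · exact measure_mono_null (Set.inter_subset_inter (body_child_subset hd has)
        (body_child_subset hd hbt)) (h.inter_null s hs t ht hst)

theorem region_redRefine {d : ℕ} (hd : d = 2 ∨ d = 3) {𝒯 : Finset (Simp d)} (h : IsTiling 𝒯) :
    region (redRefine 𝒯) = region 𝒯 := by
  ext x
  simp only [region, Set.mem_iUnion, exists_prop, mem_redRefine]
  constructor
  · rintro ⟨t', ⟨t, ht, hc⟩, hx⟩
    exact ⟨t, ht, body_child_subset hd hc hx⟩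
  · rintro ⟨t, ht, hx⟩
    obtain ⟨t', hc, hx'⟩ := exists_mem_body_child hd (h.nondegenerate t ht) hx
    exact ⟨t', ⟨t, ht, hc⟩, hx'⟩

theorem IsTiling.uniformMesh {d : ℕ} (hd : d = 2 ∨ d = 3) {𝒯H : Finset (Simp d)}
    (h : IsTiling 𝒯H) (ℓ : ℕ) : IsTiling (uniformMesh 𝒯H ℓ) := by
  induction ℓ with
  | zero => exact h
  | succ ℓ ih =>
    rw [uniformMesh_succ]
    exact ih.redRefine hd

theorem isRefinementOf_uniformMesh {d : ℕ} (hd : d = 2 ∨ d = 3) {𝒯H : Finset (Simp d)}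
    (h : IsTiling 𝒯H) (ℓ : ℕ) : IsRefinementOf (uniformMesh 𝒯H ℓ) 𝒯H := by
  constructor
  · induction ℓ with
    | zero => rfl
    | succ ℓ ih => rw [uniformMesh_succ, region_redRefine hd (h.uniformMesh hd ℓ), ih]
  · intro t ht
    obtain ⟨T, hT, hl⟩ := (mem_uniformMesh hd).1 ht
    exact ⟨T, hT, hl.body_subset (by positivity)⟩

/-- Elements of the uniformly refined mesh in the interior of a macro element can be reflected about
the midpoints of their edges. -/
theorem reflect_mem_uniformMesh {d : ℕ} (hd : d = 2 ∨ d = 3) {𝒯H : Finset (Simp d)}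
    (h : IsTiling 𝒯H) {ℓ : ℕ} {T t : Simp d} (hT : T ∈ 𝒯H)
    (ht : t ∈ elementsIn (uniformMesh 𝒯H ℓ) T)
    (hfr : frontier (body t) ∩ frontier (body T) = ∅) (i j : Fin (d + 1)) :
    reflect t i j ∈ elementsIn (uniformMesh 𝒯H ℓ) T := by
  obtain ⟨htm, htT⟩ := mem_elementsIn.1 ht
  obtain ⟨T', hT', hl⟩ := (mem_uniformMesh hd).1 htm
  have hN : (0 : ℤ) < 2 ^ ℓ := by positivity
  have hnd := h.nondegenerate T' hT'
  have htnd := hl.affineIndependent hnd hN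
  obtain rfl := h.eq_of_subset htnd hT' hT (hl.body_subset hN) htT
  have hi : t i ∈ frontier (body t) := by
    rw [(isClosed_body t).frontier_eq]
    refine ⟨vertex_mem_body t i, fun hint => ?_⟩
    obtain ⟨k, hk⟩ : ∃ k, k ≠ i := by
      have : Nontrivial (Fin (d + 1)) := Fin.nontrivial_iff_two_le.2 (by omega)
      exact exists_ne i
    have := (mem_interior_body_iff htnd).1 hint k
    rw [bary_vertex htnd, if_neg hk] at this
    exact lt_irrefl _ this
  have hint : t i ∈ interior (body T') := by
    by_contra hni
    have : t i ∈ frontier (body t) ∩ frontier (body T') := by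
      refine ⟨hi, ?_⟩
      rw [(isClosed_body T').frontier_eq]
      exact ⟨htT (vertex_mem_body t i), hni⟩
    rw [hfr] at this
    exact this
  have hr := hl.reflect hnd hN hint j
  exact mem_elementsIn.2 ⟨(mem_uniformMesh hd).2 ⟨T', hT', hr⟩, hr.body_subset hN⟩

theorem diam_le_meshSize {d : ℕ} {𝒯 : Finset (Simp d)} {t : Simp d} (ht : t ∈ 𝒯) :
    Metric.diam (body t) ≤ meshSize 𝒯 :=
  le_ciSup (f := fun t : 𝒯 => Metric.diam (body t.1)) (Set.finite_range _).bddAbove ⟨t, ht⟩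

theorem meshSize_nonneg {d : ℕ} (𝒯 : Finset (Simp d)) : 0 ≤ meshSize 𝒯 :=
  Real.iSup_nonneg fun _ => Metric.diam_nonneg

theorem diam_uniformMesh_le {d : ℕ} (hd : d = 2 ∨ d = 3) {𝒯H : Finset (Simp d)} {ℓ : ℕ}
    {t : Simp d} (ht : t ∈ uniformMesh 𝒯H ℓ) :
    Metric.diam (body t) ≤ 2 * d * (meshSize 𝒯H / 2 ^ ℓ) := by
  obtain ⟨T, hT, hl⟩ := (mem_uniformMesh hd).1 ht
  refine (hl.diam_le (by positivity)).trans ?_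
  push_cast
  gcongr
  exact diam_le_meshSize hT

theorem exists_uniformMesh_shape_bound {d : ℕ} (hd : d = 2 ∨ d = 3) {𝒯H : Finset (Simp d)}
    (h : IsTiling 𝒯H) : ∃ ρ : ℝ, ∀ ℓ, ∀ t ∈ uniformMesh 𝒯H ℓ, ∀ i,
      Metric.diam (body t) * ‖affGrad (bary t i)‖ ≤ ρ := by
  have : ∀ T, ∃ ρ : ℝ, 0 ≤ ρ ∧ (T ∈ 𝒯H → ∀ (N : ℤ) (t : Simp d), 0 < N →
      IsLatticeSimplex T N t → ∀ i, Metric.diam (body t) * ‖affGrad (bary t i)‖ ≤ ρ) := by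
    intro T
    by_cases hT : T ∈ 𝒯H
    · obtain ⟨ρ, h0, hρ⟩ := exists_shape_bound (h.nondegenerate T hT)
      exact ⟨ρ, h0, fun _ => hρ⟩
    · exact ⟨0, le_rfl, fun h => absurd h hT⟩
  choose ρ h0 hρ using this
  refine ⟨∑ T ∈ 𝒯H, ρ T, fun ℓ t ht i => ?_⟩
  obtain ⟨T, hT, hl⟩ := (mem_uniformMesh hd).1 ht
  exact (hρ T hT _ t (by positivity) hl i).trans
    (Finset.single_le_sum (f := ρ) (fun T _ => h0 T) hT)

/-- A simplex that contains a ball of radius `r` has gradients of barycentric coordinates of length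
at most `1/r`, since these coordinates take values in `[0, 1]`. -/
theorem mul_norm_affGrad_bary_le {d : ℕ} {t : Simp d} (ht : AffineIndependent ℝ t) {c : Space d}
    {r : ℝ} (hr : 0 ≤ r) (h : Metric.closedBall c r ⊆ body t) (i : Fin (d + 1)) :
    r * ‖affGrad (bary t i)‖ ≤ 1 := by
  set g := affGrad (bary t i) with hg
  rcases eq_or_ne g 0 with h0 | h0
  · rw [h0]
    simp
  have hgn : 0 < ‖g‖ := norm_pos_iff.2 h0
  set y := c + (r / ‖g‖) • g with hy
  have hyb : y ∈ body t := h (by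
    rw [Metric.mem_closedBall, hy, dist_eq_norm, add_sub_cancel_left, norm_smul,
      Real.norm_of_nonneg (by positivity), div_mul_cancel₀ _ hgn.ne'])
  have hcb : c ∈ body t := h (Metric.mem_closedBall_self hr)
  have h1 : bary t i y ≤ 1 := by
    rw [← sum_bary ht y]
    exact Finset.single_le_sum (f := fun i => bary t i y)
      (fun k _ => (mem_body_iff ht).1 hyb k) (Finset.mem_univ i)
  have h2 := (mem_body_iff ht).1 hcb i
  have h3 : bary t i y - bary t i c = r * ‖g‖ := by
    rw [← inner_affGrad_sub, hy, add_sub_cancel_left, real_inner_smul_right,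
      real_inner_self_eq_norm_sq, ← hg]
    field_simp
  linarith

end StencilScaling

theorem lemma3p3 {d : ℕ} (hd : d = 2 ∨ d = 3) (𝒯H : Finset (Simp d)) (hH : IsTriangulation 𝒯H) :
    -- (A2) on the uniformly refined meshes, `h = H / 2 ^ ℓ`
    (∃ C : ℝ, ∀ (ℓ : ℕ) (k : Space d → ℝ) (kT : Simp d → Space d → ℝ) (gk : Space d → Space d)
      (Hk : Space d → Space d →L[ℝ] Space d), IsBrokenW2Infty 𝒯H k kT gk Hk →
      ∀ v w : Space d → ℝ, IsFE (uniformMesh 𝒯H ℓ) v → IsFE (uniformMesh 𝒯H ℓ) w →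
        |exactForm (domain 𝒯H) k v w - scaledForm 𝒯H (uniformMesh 𝒯H ℓ) kT v w| ≤
          C * (meshSize 𝒯H / 2 ^ ℓ) * brokenSupNorm 𝒯H gk *
            gradNorm (domain 𝒯H) v * gradNorm (domain 𝒯H) w) ∧
    -- (A3) on the uniformly refined meshes
    (∃ C : ℝ, ∀ (ℓ : ℕ) (k : Space d → ℝ) (kT : Simp d → Space d → ℝ) (gk : Space d → Space d)
      (Hk : Space d → Space d →L[ℝ] Space d), IsBrokenW2Infty 𝒯H k kT gk Hk →
      ∀ v w : Space d → ℝ, IsFE (uniformMesh 𝒯H ℓ) v → IsFE (uniformMesh 𝒯H ℓ) w →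
        |exactForm (domain 𝒯H) k v w - scaledForm 𝒯H (uniformMesh 𝒯H ℓ) kT v w| ≤
          C * ((meshSize 𝒯H / 2 ^ ℓ) ^ 2 * brokenSupNorm 𝒯H Hk *
              gradNorm (domain 𝒯H) v * gradNorm (domain 𝒯H) w +
            meshSize 𝒯H / 2 ^ ℓ * brokenSupNorm 𝒯H gk *
              gradNorm (strip 𝒯H (uniformMesh 𝒯H ℓ)) v *
              gradNorm (strip 𝒯H (uniformMesh 𝒯H ℓ)) w)) ∧
    -- (A2) on arbitrary shape-regular refinements of the macro mesh
    (∀ σ : ℝ, 0 < σ → ∃ C : ℝ, ∀ 𝒯 : Finset (Simp d), IsTriangulation 𝒯 →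
      IsRefinementOf 𝒯 𝒯H → IsShapeRegular σ 𝒯 →
      ∀ (k : Space d → ℝ) (kT : Simp d → Space d → ℝ) (gk : Space d → Space d)
        (Hk : Space d → Space d →L[ℝ] Space d), IsBrokenW2Infty 𝒯H k kT gk Hk →
      ∀ v w : Space d → ℝ, IsFE 𝒯 v → IsFE 𝒯 w →
        |exactForm (domain 𝒯H) k v w - scaledForm 𝒯H 𝒯 kT v w| ≤
          C * meshSize 𝒯 * brokenSupNorm 𝒯H gk *
            gradNorm (domain 𝒯H) v * gradNorm (domain 𝒯H) w) := by

  have hTil := hH.isTiling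
  obtain ⟨ρ, hρ⟩ := exists_uniformMesh_shape_bound hd hTil
  -- the diameters of the elements are at most `2 * d * h`, hence the factors `2 * d`
  refine ⟨⟨(d + 1) ^ 2 * ρ ^ 2 * (2 * d), fun ℓ k kT gk Hk hk v w hv hw => ?_⟩,
    ⟨(d + 1) ^ 2 * ρ ^ 2 * (2 * d) ^ 2, fun ℓ k kT gk Hk hk v w hv hw => ?_⟩,
    fun σ hσ => ⟨(d + 1) ^ 2 * σ ^ 2, fun 𝒯 h𝒯 hr hs k kT gk Hk hk v w hv hw => ?_⟩⟩
  · have hδ0 : 0 ≤ 2 * d * (meshSize 𝒯H / 2 ^ ℓ) :=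
      mul_nonneg (by positivity) (div_nonneg (meshSize_nonneg _) (by positivity))
    refine (first_order_bound hTil (hTil.uniformMesh hd ℓ) (isRefinementOf_uniformMesh hd hTil ℓ)
      (hρ ℓ) (fun t ht => diam_uniformMesh_le hd ht) hδ0 hk hv hw).trans (le_of_eq ?_)
    ring
  · have hH0 : 0 ≤ meshSize 𝒯H / 2 ^ ℓ := div_nonneg (meshSize_nonneg _) (by positivity)
    refine (second_order_bound hTil (hTil.uniformMesh hd ℓ) (isRefinementOf_uniformMesh hd hTil ℓ)
      (hρ ℓ) (fun t ht => diam_uniformMesh_le hd ht) (mul_nonneg (by positivity) hH0)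
      (fun T hT t ht hfr i j => reflect_mem_uniformMesh hd hTil hT ht hfr i j) hk hv hw).trans ?_
    rw [mul_assoc ((d + 1 : ℝ) ^ 2 * ρ ^ 2)]
    refine mul_le_mul_of_nonneg_left ?_ (by positivity)
    rw [mul_add]
    refine add_le_add (le_of_eq (by ring)) ?_
    have hX : 0 ≤ meshSize 𝒯H / 2 ^ ℓ * brokenSupNorm 𝒯H gk *
        gradNorm (strip 𝒯H (uniformMesh 𝒯H ℓ)) v * gradNorm (strip 𝒯H (uniformMesh 𝒯H ℓ)) w :=
      mul_nonneg (mul_nonneg (mul_nonneg hH0 ENNReal.toReal_nonneg) (Real.sqrt_nonneg _))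
        (Real.sqrt_nonneg _)
    have h1 : (2 * d : ℝ) ≤ (2 * d) ^ 2 := by
      have : (1 : ℝ) ≤ d := by exact_mod_cast (by omega : 1 ≤ d)
      nlinarith
    refine (le_of_eq ?_).trans (mul_le_mul_of_nonneg_right h1 hX)
    ring
  · have hshape : ∀ t ∈ 𝒯, ∀ i, Metric.diam (body t) * ‖affGrad (bary t i)‖ ≤ σ := by
      intro t ht i
      obtain ⟨c, hc⟩ := hs t ht
      have := mul_norm_affGrad_bary_le (h𝒯.nondegenerate t ht)
        (div_nonneg Metric.diam_nonneg hσ.le) hc i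
      rwa [div_mul_eq_mul_div, div_le_one hσ] at this
    exact first_order_bound hTil h𝒯.isTiling hr hshape (fun t ht => diam_le_meshSize ht)
      (meshSize_nonneg 𝒯) hk hv hw
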